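/- Let $\Bbbk$ be an algebraically closed field, $m\ge 0$, and let $G\le \mathrm{GL}_m(\Bbbk)$ be a linear algebraic group over $\Bbbk$ (a Zariski closed subgroup). Let $T_{loc}$ be the theory of nontrivially valued algebraically closed fields $(\mathrm{VF},\mathrm{val})$, with valuation ring $\mathcal{O}$, together with a subfield $\mathrm{RES}\subseteq\mathcal{O}$ that contains $\Bbbk$ (whose elements are named by constants) and maps isomorphically onto the residue field; $\mathrm{res}$ is the residue map, with values in $\mathrm{RES}$. Let $\mathcal{L}_{\mathrm{val}}$ be the language of valued fields with constants for $\Bbbk$, and fix a monster model $\mathbb{U}$ of $T_{loc}$ (it is enough that $\mathbb{U}$ is $|\Bbbk|^+$-saturated). Write $\mathbf{G}=G(\mathbb{U})$, $\overline{\mathbf{G}}=G(\mathrm{RES})\subseteq\mathbf{G}$, and let $\mu$ be the kernel of the residue map $\mathbf{G}(\mathcal{O})\to\overline{\mathbf{G}}$. Let $S_G(\Bbbk)$ be the set of complete $\mathcal{L}_{\mathrm{val}}$-types over $\Bbbk$ of elements of $\mathbf{G}$. For $p\in S_G(\Bbbk)$ let $\mu\cdot p$ be the partial type consisting of the sets $\mu\cdot\psi(\mathbb{U})$,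 where $\psi\in p$ is a formula implying $x\in\mathbf{G}$, and identify it with its set of realizations in $\mathbb{U}$. Put: * $\mathrm{Stab}^\mu(p)=\{h\in G(\Bbbk) : \text{for every } \Bbbk\text{-definable } X\subseteq\mathbf{G},\ \mu\cdot p\subseteq h\cdot X \iff \mu\cdot p\subseteq X\}$, where definability is in the language of $T_{loc}$; * $\overline{\mathbf{G}}_p=\big((\mu\cdot p)\cdot(\mu\cdot p)^{-1}\big)\cap\overline{\mathbf{G}}$, and $\overline{\mathbf{G}}_p(\Bbbk)=\overline{\mathbf{G}}_p\cap G(\Bbbk)$; * $\dim(p)$ = the dimension of the Zariski closure of $p$ in $G$ over $\Bbbk$, that is, of the zero set of all polynomials $f$ over $\Bbbk$ such that $p(x)$ implies $f(x)=0$. Then, for every $p\in S_G(\Bbbk)$, $$\dim\big(\mathrm{Stab}^\mu(p)\big)=\dim\overline{\mathbf{G}}_p(\Bbbk)\le\dim(p),$$ where the dimension of the first two sets is their Krull dimension as subspaces of $G(\Bbbk)$ with the Zariski topology. Moreover $\dim(p)$ is the minimum of the $\mathrm{VF}$-dimensions of the formulas $\varphi\in p$ implying $x\in\mathbf{G}$,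 where the $\mathrm{VF}$-dimension of $\varphi$ is the dimension of the Zariski closure over $\Bbbk$ of the set defined by $\varphi$. -/

import Mathlib

open FirstOrder

universe u v

namespace MuStab

section ZariskiTopology

/-- The matrix entries of an element of `GL_m(F)`, as a tuple indexed by pairs. -/
def coords {F : Type*} [Field F] {m : ℕ} (g : GL (Fin m) F) : Fin m × Fin m → F :=
  fun ij => g.val ij.1 ij.2

variable {k : Type u} [Field k] {m : ℕ}

/-- The Zariski topology on `GL_m(k)`: the sets `{g | f(g) ≠ 0}`, for `f` a polynomial in the
matrix entries, form a basis of open sets.  (The determinant is invertible on `GL_m`, so allowing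
its inverse in `f` would not give more open sets.) -/
@[reducible] def zariski (k : Type u) [Field k] (m : ℕ) : TopologicalSpace (GL (Fin m) k) :=
  TopologicalSpace.generateFrom
    {s | ∃ f : MvPolynomial (Fin m × Fin m) k, s = {g | MvPolynomial.eval (coords g) f ≠ 0}}

/-- The Krull dimension of a subset of `GL_m(k)` with the topology induced by the Zariski
topology. -/
noncomputable def zdim (S : Set (GL (Fin m) k)) : WithBot ℕ∞ :=
  @topologicalKrullDim S (TopologicalSpace.induced Subtype.val (zariski k m))

/-- A linear algebraic group over `k` (algebraically closed): a Zariski closed subgroup of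
`GL_m(k)`. -/
def IsLinearAlgebraicGroup (G : Subgroup (GL (Fin m) k)) : Prop :=
  @IsClosed _ (zariski k m) (G : Set (GL (Fin m) k))

end ZariskiTopology

section Language

/-- Function symbols of the language of valued fields over `k`: the ring operations and a constant
for every element of `k`. -/
inductive ValFunctions (k : Type u) : ℕ → Type u
  | zero : ValFunctions k 0
  | one : ValFunctions k 0
  | const (c : k) : ValFunctions k 0
  | neg : ValFunctions k 1
  | add : ValFunctions k 2
  | mul : ValFunctions k 2

/-- Relation symbols of the language of valued fields: the relation `val x ≤ val y`. -/
inductive ValRelations : ℕ → Type u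
  | valLE : ValRelations 2

/-- The language of valued fields over `k`, on the valued field sort.  The value group (with `∞`)
is the quotient of the field by the equivalence relation `val x ≤ val y ∧ val y ≤ val x`, and the
residue field is the quotient of `{x | val 1 ≤ val x}` by `val (x - y) > val 1`; hence formulas
in field variables in this language and in the language with separate sorts for the value group
and the residue field define the same sets. -/
def valLang (k : Type u) : Language := ⟨ValFunctions k, ValRelations.{u}⟩

/-- The additional function symbol of the language of `T_loc`: `res (x, y)`. -/
inductive LocFunctions : ℕ → Type u
  | res : LocFunctions 2

/-- The additional relation symbol of the language of `T_loc`: the predicate `RES`. -/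
inductive LocRelations : ℕ → Type u
  | isRes : LocRelations 1

/-- The symbols of `T_loc` which are not symbols of valued fields.  (The argument `k` only serves
to find the interpretation.) -/
def extraLang (_k : Type u) : Language := ⟨LocFunctions.{u}, LocRelations.{u}⟩

/-- The language of `T_loc` over `k`: valued fields with an embedded residue field. -/
abbrev locLang (k : Type u) : Language := (valLang k).sum (extraLang k)

end Language

/-- A model of `T_loc`, with constants for the elements of the field `k` in the residue field:
a nontrivially valued algebraically closed field `U` with valuation ring `O` (the valuation is
`O.valuation`), together with a subfield `RES ⊆ O` containing `k` that maps onto, hence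
isomorphically to, the residue field of `O`.
Mathlib writes valuations multiplicatively: `val x ≤ val y` is `O.valuation y ≤ O.valuation x`,
and `val x > 0` is `O.valuation x < 1`. -/
class LocModel (k : Type u) (U : Type v) [Field k] [Field U] [Algebra k U] where
  O : ValuationSubring U
  RES : Subfield U
  isAlgClosed : IsAlgClosed U
  nontrivial : O ≠ ⊤
  algebraMap_mem : ∀ c : k, algebraMap k U c ∈ RES
  RES_le : ∀ x ∈ RES, x ∈ O
  exists_res : ∀ x ∈ O, ∃ c ∈ RES, O.valuation (x - c) < 1

section Structures

variable (k : Type u) {U : Type v} [Field k] [Field U] [Algebra k U] [LocModel k U]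

/-- The representative in `RES` of the residue class of `x ∈ O` is unique. -/
theorem res_unique {x c d : U} (hc : c ∈ LocModel.RES k (U := U)) (hd : d ∈ LocModel.RES k (U := U))
    (hxc : (LocModel.O k (U := U)).valuation (x - c) < 1)
    (hxd : (LocModel.O k (U := U)).valuation (x - d) < 1) : c = d := by
  by_contra hne
  have hsub : c - d ∈ LocModel.RES k (U := U) := sub_mem hc hd
  have hinv := LocModel.RES_le (k := k) _ (inv_mem hsub)
  have h1 : (LocModel.O k (U := U)).valuation (c - d) < 1 := by
    have : c - d = (x - d) - (x - c) := by ring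
    rw [this]
    exact lt_of_le_of_lt (Valuation.map_sub _ _ _) (max_lt hxd hxc)
  have h2 := (ValuationSubring.valuation_le_one_iff _ _).2 hinv
  have h3 : (LocModel.O k (U := U)).valuation ((c - d) * (c - d)⁻¹) < 1 := by
    rw [map_mul]
    exact mul_lt_one_of_lt_of_le h1 h2
  rw [mul_inv_cancel₀ (sub_ne_zero.2 hne), map_one] at h3
  exact lt_irrefl _ h3

open Classical in
/-- `res (x, y)` is the residue in `RES` of `x / y` if `val x ≥ val y` (and `y ≠ 0`), and `0`
otherwise. -/
noncomputable def res₂ (x y : U) : U :=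
  if h : x / y ∈ LocModel.O k (U := U) ∧ y ≠ 0 then
    (LocModel.exists_res (k := k) (x / y) h.1).choose else 0

/-- `res x = res (x, 1)`, the residue of `x ∈ O` as an element of `RES`. -/
noncomputable def res (x : U) : U := res₂ k x 1

variable {k}

noncomputable instance valStructure : (valLang k).Structure U where
  funMap
    | ValFunctions.zero, _ => 0
    | ValFunctions.one, _ => 1
    | ValFunctions.const c, _ => algebraMap k U c
    | ValFunctions.neg, x => -x 0
    | ValFunctions.add, x => x 0 + x 1
    | ValFunctions.mul, x => x 0 * x 1
  RelMap
    | ValRelations.valLE, x =>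
      (LocModel.O k (U := U)).valuation (x 1) ≤ (LocModel.O k (U := U)).valuation (x 0)

noncomputable instance extraStructure : (extraLang k).Structure U where
  funMap
    | LocFunctions.res, x => res₂ k (x 0) (x 1)
  RelMap
    | LocRelations.isRes, x => x 0 ∈ LocModel.RES k (U := U)

variable (k U)

/-- `U` is a monster model of `T_loc` over `k`, i.e. it is sufficiently saturated: every family of
sets of finite tuples, definable in the language of `T_loc` over a common parameter set of
cardinality at most that of `k`, has nonempty intersection as soon as every finite subfamily
does. -/
def IsMonster : Prop :=
  ∀ A : Set U, Cardinal.lift.{u} (Cardinal.mk A) ≤ Cardinal.lift.{v} (Cardinal.mk k) →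
    ∀ (ι : Type) [Finite ι] (F : Set (Set (ι → U))),
      (∀ X ∈ F, A.Definable (locLang k) X) →
      (∀ F₀ ⊆ F, F₀.Finite → (⋂₀ F₀).Nonempty) → (⋂₀ F).Nonempty

end Structures

section Types

variable (k : Type u) (U : Type v) [Field k] [Field U] [Algebra k U] [LocModel k U]

/-- Complete types over `k`, in the language of valued fields, in field variables indexed by
`ι`. -/
abbrev TypesOver (ι : Type) := ((valLang k).completeTheory U).CompleteType ι

variable {k U} {ι : Type}

/-- The formula `ψ` belongs to the type `p`. -/
def Contains (p : TypesOver k U ι) (ψ : (valLang k).Formula ι) : Prop :=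
  Language.Formula.equivSentence ψ ∈ p

/-- The type `p` implies that its variables lie in `X`. -/
def Implies (p : TypesOver k U ι) (X : Set (ι → U)) : Prop :=
  ∃ ψ, Contains p ψ ∧ ∀ x : ι → U, ψ.Realize x → x ∈ X

end Types

section Groups

variable {k : Type u} [Field k] {m : ℕ} (G : Subgroup (GL (Fin m) k))
  (U : Type v) [Field U] [Algebra k U]

/-- The inclusion of `GL_m(k)` in `GL_m(U)`. -/
abbrev incl (k : Type u) [Field k] (m : ℕ) (U : Type v) [Field U] [Algebra k U] :
    GL (Fin m) k →* GL (Fin m) U :=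
  Matrix.GeneralLinearGroup.map (algebraMap k U)

/-- The `U`-points of the linear algebraic group `G` over `k`: the zeros in `GL_m(U)` of all
polynomials over `k` that vanish on `G`. -/
def points : Set (GL (Fin m) U) :=
  {g | ∀ f : MvPolynomial (Fin m × Fin m) k,
    (∀ x ∈ G, MvPolynomial.eval (coords x) f = 0) → MvPolynomial.aeval (coords g) f = 0}

variable [LocModel k U]

/-- The `O`-points of `G`. -/
def integralPoints : Set (GL (Fin m) U) :=
  {g | g ∈ points G U ∧ (∀ i j, g.val i j ∈ LocModel.O k (U := U)) ∧
    ∀ i j, g⁻¹.val i j ∈ LocModel.O k (U := U)}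

/-- The `RES`-points of `G`. -/
def residuePoints : Set (GL (Fin m) U) :=
  {g | g ∈ points G U ∧ ∀ i j, g.val i j ∈ LocModel.RES k (U := U)}

/-- The infinitesimal subgroup `μ`: the kernel of the entrywise residue map from the `O`-points
to the `RES`-points of `G`. -/
def mu : Set (GL (Fin m) U) :=
  {g | g ∈ integralPoints G U ∧ ∀ i j, res k (g.val i j) = (1 : Matrix (Fin m) (Fin m) U) i j}

variable {U}

/-- `ψ` is a `G`-formula: `ψ(x)` implies `x ∈ G`. -/
def IsGFormula (U : Type v) [Field U] [Algebra k U] [LocModel k U]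
    (ψ : (valLang k).Formula (Fin m × Fin m)) : Prop :=
  ∀ x : Fin m × Fin m → U, ψ.Realize x → ∃ g ∈ points G U, coords g = x

/-- `p` is a complete type on `G`, that is, an element of `S_G(k)`: it contains a `G`-formula. -/
def IsTypeOn (p : TypesOver k U (Fin m × Fin m)) : Prop :=
  ∃ ψ, Contains p ψ ∧ IsGFormula G U ψ

/-- The set defined by `μ · ψ` in `U`. -/
def muMul (ψ : (valLang k).Formula (Fin m × Fin m)) : Set (GL (Fin m) U) :=
  {x | ∃ e ∈ mu G U, ∃ y ∈ points G U, ψ.Realize (coords y) ∧ x = e * y}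

/-- The set of realizations in `U` of the partial type `μ · p = {μ · ψ | ψ ∈ p}`, where `ψ` runs
over the `G`-formulas in `p`. -/
def tube (p : TypesOver k U (Fin m × Fin m)) : Set (GL (Fin m) U) :=
  {x | ∀ ψ, Contains p ψ → IsGFormula G U ψ → x ∈ muMul G ψ}

/-- The `μ`-stabilizer of `p` (its `k`-points): the stabilizer of the partial type `μ · p`, that is,
all `h ∈ G(k)` such that `μ · p` implies `h · X` if and only if it implies `X`, for all subsets `X`
of `G` definable over `k` in the language of `T_loc`. -/
def muStab (p : TypesOver k U (Fin m × Fin m)) : Set (GL (Fin m) k) :=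
  {h | h ∈ G ∧ ∀ X : Set (GL (Fin m) U), X ⊆ points G U →
    (∅ : Set U).Definable (locLang k) (coords '' X) →
      (tube G p ⊆ (fun x => incl k m U h * x) '' X ↔ tube G p ⊆ X)}

/-- The set `((μ · p) · (μ · p)⁻¹) ∩ G(RES)`. -/
def Gbar (p : TypesOver k U (Fin m × Fin m)) : Set (GL (Fin m) U) :=
  {g | (∃ x ∈ tube G p, ∃ y ∈ tube G p, g = x * y⁻¹) ∧ g ∈ residuePoints G U}

/-- The `k`-points of the previous set. -/
def GbarPoints (p : TypesOver k U (Fin m × Fin m)) : Set (GL (Fin m) k) :=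
  {g | g ∈ G ∧ incl k m U g ∈ Gbar G p}

/-- The Zariski closure over `k` of the type `p`, given by its `k`-points: the common zeros of all
polynomials `f` over `k` such that `p(x)` implies `f(x) = 0`. -/
def typeClosure (p : TypesOver k U (Fin m × Fin m)) : Set (GL (Fin m) k) :=
  {g | ∀ f : MvPolynomial (Fin m × Fin m) k, Implies p {x | MvPolynomial.aeval x f = 0} →
    MvPolynomial.eval (coords g) f = 0}

/-- The Zariski dimension `dim p` of `p`: the dimension of its Zariski closure over `k`. -/
noncomputable def typeDim (p : TypesOver k U (Fin m × Fin m)) : WithBot ℕ∞ :=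
  zdim (typeClosure p)

/-- The Zariski closure over `k` of the set defined by `ψ` in `U`, given by its `k`-points. -/
def formulaClosure (U : Type v) [Field U] [Algebra k U] [LocModel k U]
    (ψ : (valLang k).Formula (Fin m × Fin m)) : Set (GL (Fin m) k) :=
  {g | ∀ f : MvPolynomial (Fin m × Fin m) k,
    (∀ x : Fin m × Fin m → U, ψ.Realize x → MvPolynomial.aeval x f = 0) →
    MvPolynomial.eval (coords g) f = 0}

/-- The `VF`-dimension of a formula over `k`: the dimension of the Zariski closure of the set that
it defines. -/
noncomputable def vfDim (U : Type v) [Field U] [Algebra k U] [LocModel k U]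
    (ψ : (valLang k).Formula (Fin m × Fin m)) : WithBot ℕ∞ :=
  zdim (formulaClosure U ψ)

end Groups

end MuStab

/-! The stabilizer and the quotient set have the same `k`-points. By saturation, `μ · p` is the set
of products `e * b` with `e ∈ μ` and `b` a realization of `p` (`mem_tube_iff`). A point `h ∈ G(k)`
has entries in `𝒪`, so it normalizes `μ`, and since `μ · ψ` is definable over `k`, whether `h * b ∈
μ · p` does not depend on the realization `b`. Hence `h · (μ · p)` is contained in `μ · p` as soon
as it meets it (`mul_mem_tube`). Applied to `h` and `h⁻¹`, this identifies both sets with the set of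
`h` for which the two meet (`muStab_eq_GbarPoints`).

For the inequality, fix a realization `a` of `p` and let `d` be the dimension of its locus `V` over
`k`. If `h` lies in the set, then `h * a = e * b` with `e ∈ μ` and `b` realizing `p`, so `b ∈ V` and
`h` is the residue of `b * a⁻¹`. So it suffices that residues of points of the translate `V * a⁻¹`
form a set of dimension at most `d` (`zdim_le_zdim_locus`). By Noether normalization, more than `d`
polynomials satisfy a nonzero algebraic relation over `U` on `V * a⁻¹` (`exists_relation_of_lt`).
Scaled to have integral coefficients and nonzero reduction, the relation passes to residues, and a
linear functional on the residue field brings its coefficients down to `k`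
(`exists_relation_of_residue`). So no more than `d` polynomials are algebraically independent on the
set of all such `h`, which bounds its Krull dimension (`zdim_le_of_forall`).

The minimum is attained because the ideal of `V` is finitely generated: its generators vanish on a
single formula of `p` (`exists_formulaClosure_eq`). -/

namespace MuStab

/-! ### Krull dimension, transcendence degree and the Nullstellensatz -/

section DimensionTheory

theorem ringKrullDim_le_of_isIntegral (R S : Type*) [CommRing R] [CommRing S] [Algebra R S]
    [Algebra.IsIntegral R S] : ringKrullDim S ≤ ringKrullDim R :=
  Order.krullDim_le_of_strictMono (PrimeSpectrum.comap (algebraMap R S))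
    fun _ _ h => Ideal.IsIntegral.comap_lt_comap h

/-- Lying over provides a prime above the smallest member of a chain, and going up lifts the rest of
the chain. -/
theorem ringKrullDim_le_of_isIntegral_of_injective (R S : Type*) [CommRing R] [CommRing S]
    [Algebra R S] [Algebra.IsIntegral R S] (h : Function.Injective (algebraMap R S)) :
    ringKrullDim R ≤ ringKrullDim S := by
  refine iSup_le fun l => ?_
  obtain ⟨Q, -, hQ, hQl⟩ := Ideal.exists_ideal_over_prime_of_isIntegral l.head.asIdeal (⊥ : Ideal S)
    (by rw [← RingHom.ker, (RingHom.injective_iff_ker_eq_bot _).1 h]; exact bot_le)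
  have : Q.LiesOver l.head.asIdeal := ⟨hQl.symm⟩
  obtain ⟨l', hl', -, -⟩ := Ideal.exists_ltSeries_of_hasGoingUp l Q
  rw [← hl']
  exact Order.LTSeries.length_le_krullDim l'

/-- Noether normalization, with the number of variables equal to the Krull dimension. -/
theorem exists_noether_normalization (k A : Type*) [Field k] [CommRing A] [Nontrivial A]
    [Algebra k A] [Algebra.FiniteType k A] :
    ∃ (d : ℕ) (g : MvPolynomial (Fin d) k →ₐ[k] A), Function.Injective g ∧
      g.IsIntegral ∧ ringKrullDim A = d := by
  obtain ⟨d, g, hinj, hint⟩ := exists_integral_inj_algHom_of_fg k A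
  refine ⟨d, g, hinj, hint, ?_⟩
  let := g.toRingHom.toAlgebra
  have : Algebra.IsIntegral (MvPolynomial (Fin d) k) A := ⟨hint⟩
  have hd : ringKrullDim (MvPolynomial (Fin d) k) = d := by
    rw [MvPolynomial.ringKrullDim_of_isNoetherianRing, ringKrullDim_eq_zero_of_field]
    simp
  rw [← hd]
  exact le_antisymm (ringKrullDim_le_of_isIntegral _ _)
    (ringKrullDim_le_of_isIntegral_of_injective _ _ hinj)

/-- The values at `t` of nonzero polynomials form a multiplicative set that avoids `0`, and a prime
disjoint from it preserves independence. This reduces questions about a ring of functions, which has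
zero divisors, to a domain, where transcendence degrees add up. -/
theorem exists_prime_algebraicIndependent_quotient {K B ι : Type*} [Field K] [CommRing B]
    [Algebra K B] {t : ι → B} (ht : AlgebraicIndependent K t) :
    ∃ q : Ideal B, q.IsPrime ∧ AlgebraicIndependent K fun i => Ideal.Quotient.mk q (t i) := by
  obtain ⟨q, hq, -, hqS⟩ := Ideal.exists_le_prime_disjoint (⊥ : Ideal B)
    ((nonZeroDivisors (MvPolynomial ι K)).map (MvPolynomial.aeval (R := K) t)) (by
      rw [Set.disjoint_left]
      rintro x hx ⟨F, hF, rfl⟩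
      have : F = 0 := (injective_iff_map_eq_zero (MvPolynomial.aeval (R := K) t)).1 ht F
        (by simpa using hx)
      exact nonZeroDivisors.ne_zero hF this)
  refine ⟨q, hq, (injective_iff_map_eq_zero (MvPolynomial.aeval (R := K) _)).2 fun F hF => ?_⟩
  by_contra hne
  refine Set.disjoint_left.1 hqS (show MvPolynomial.aeval t F ∈ _ from ?_)
    ⟨F, mem_nonZeroDivisors_of_ne_zero hne, rfl⟩
  have h := MvPolynomial.comp_aeval t (Ideal.Quotient.mkₐ K q)
  rw [SetLike.mem_coe, ← Ideal.Quotient.eq_zero_iff_mem]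
  have h' := DFunLike.congr_fun h F
  simp only [AlgHom.comp_apply, Ideal.Quotient.mkₐ_eq_mk] at h'
  rw [h']
  exact hF

/-- Algebraically independent elements that are integral over a subalgebra with `d` generators
are at most `d` in number. -/
theorem card_le_of_isIntegral_adjoin {K B : Type*} [Field K] [CommRing B] [Algebra K B] {d r : ℕ}
    (y : Fin d → B) (t : Fin r → B) (ht : AlgebraicIndependent K t)
    (hint : ∀ i, IsIntegral (Algebra.adjoin K (Set.range y)) (t i)) : r ≤ d := by
  obtain ⟨q, hq, htq⟩ := exists_prime_algebraicIndependent_quotient ht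
  set π := Ideal.Quotient.mkₐ K q
  let C : Subalgebra K (B ⧸ q) := Algebra.adjoin K (Set.range fun i => π (y i))
  have hC : (Algebra.adjoin K (Set.range y)).map π = C := by
    rw [AlgHom.map_adjoin, ← Set.range_comp]; rfl
  have hintC : ∀ i, IsIntegral C (π (t i)) := by
    intro i
    obtain ⟨p, hp, hpt⟩ := hint i
    let σ : Algebra.adjoin K (Set.range y) →+* C :=
      ((π.domRestrict (Algebra.adjoin K (Set.range y))).codRestrict C
        (fun x => hC ▸ ⟨x, x.2, rfl⟩)).toRingHom
    refine ⟨p.map σ, hp.map _, ?_⟩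
    rw [Polynomial.eval₂_map]
    have : (algebraMap C (B ⧸ q)).comp σ = π.toRingHom.comp (algebraMap _ B) := rfl
    rw [this]
    have h2 := Polynomial.hom_eval₂ p (algebraMap (Algebra.adjoin K (Set.range y)) B) π.toRingHom
      (t i)
    rw [hpt, map_zero] at h2
    exact h2.symm
  -- The images of the `t i` lie in `D`, which is algebraic over `C`, and `C` has transcendence
  -- degree at most `d` as a quotient of a polynomial ring in `d` variables.
  let D := integralClosure C (B ⧸ q)
  have htD : AlgebraicIndependent K (fun i => (⟨π (t i), hintC i⟩ : D)) :=
    (AlgHom.algebraicIndependent_iff (D.val.restrictScalars K) Subtype.val_injective).1 htq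
  have h1 := htD.lift_cardinalMk_le_trdeg
  have h2 : Algebra.trdeg K C ≤ d := by
    have hsurj : Function.Surjective ((MvPolynomial.aeval fun i => π (y i)).codRestrict C
        (fun F => by
          simp only [C, Algebra.adjoin_range_eq_range_aeval]
          exact ⟨F, rfl⟩)) := by
      rintro ⟨c, hc⟩
      have hc' := hc
      simp only [C, Algebra.adjoin_range_eq_range_aeval] at hc'
      obtain ⟨F, rfl⟩ := hc'
      exact ⟨F, rfl⟩
    have := lift_trdeg_le_of_surjective _ hsurj
    rw [MvPolynomial.trdeg_of_isDomain] at this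
    simpa using this
  have : FaithfulSMul K C := (faithfulSMul_iff_algebraMap_injective K C).2 (algebraMap K C).injective
  have : FaithfulSMul C D := (faithfulSMul_iff_algebraMap_injective C D).2 fun a b hab =>
    Subtype.ext (congrArg (Subtype.val : D → B ⧸ q) hab)
  have h3 : Algebra.trdeg K C + Algebra.trdeg C D = Algebra.trdeg K D := trdeg_add_eq K C
  have : Algebra.IsAlgebraic C D := Algebra.IsIntegral.isAlgebraic
  rw [trdeg_eq_zero (R := C), add_zero] at h3
  rw [← h3] at h1
  simpa using h1.trans (Cardinal.lift_le.2 h2)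

/-- Nullstellensatz: in a Jacobson ring a prime is the intersection of the maximal ideals above it,
and their residue fields are finite over `k`, hence equal to `k`. -/
theorem exists_algHom_of_notMem_prime {k A : Type*} [Field k] [IsAlgClosed k] [CommRing A]
    [Algebra k A] [Algebra.FiniteType k A] (Q : Ideal A) [hQ : Q.IsPrime] {f : A} (hf : f ∉ Q) :
    ∃ φ : A →ₐ[k] k, (∀ x ∈ Q, φ x = 0) ∧ φ f ≠ 0 := by
  have hJ : IsJacobsonRing A := isJacobsonRing_of_finiteType (A := k)
  rw [← IsJacobsonRing.out hJ hQ.isRadical, Ideal.jacobson, Ideal.mem_sInf] at hf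
  push Not at hf
  obtain ⟨M, ⟨hQM, hM⟩, hfM⟩ := hf
  let := Ideal.Quotient.field M
  have : Module.Finite k (A ⧸ M) := finite_of_finite_type_of_isJacobsonRing k (A ⧸ M)
  let e := AlgEquiv.ofBijective (Algebra.ofId k (A ⧸ M))
    (IsAlgClosed.algebraMap_bijective_of_isIntegral)
  refine ⟨e.symm.toAlgHom.comp (Ideal.Quotient.mkₐ k M), fun x hx => ?_, fun h => hfM ?_⟩
  · have : Ideal.Quotient.mkₐ k M x = 0 := Ideal.Quotient.eq_zero_iff_mem.2 (hQM hx)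
    simp only [AlgHom.comp_apply, this, map_zero]
  · have h' : e.symm (Ideal.Quotient.mkₐ k M f) = 0 := h
    rw [map_eq_zero_iff _ e.symm.injective] at h'
    exact Ideal.Quotient.eq_zero_iff_mem.1 h'

end DimensionTheory

/-! ### Descent of polynomial relations to the base field -/

section ExtensionOfScalars

variable {k K σ : Type*} [Field k] [Field K] [Algebra k K]

/-- The polynomial obtained by applying a linear functional to all coefficients. -/
noncomputable def mapCoeff (l : K →ₗ[k] k) (F : MvPolynomial σ K) : MvPolynomial σ k :=
  ∑ s ∈ F.support, MvPolynomial.monomial s (l (F.coeff s))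

theorem coeff_mapCoeff (l : K →ₗ[k] k) (F : MvPolynomial σ K) (s : σ →₀ ℕ) :
    (mapCoeff l F).coeff s = l (F.coeff s) := by
  classical
  rw [mapCoeff, MvPolynomial.coeff_sum]
  simp only [MvPolynomial.coeff_monomial]
  rw [Finset.sum_ite_eq']
  split_ifs with h
  · rfl
  · rw [MvPolynomial.notMem_support_iff.1 h, map_zero]

theorem eval_mapCoeff (l : K →ₗ[k] k) (F : MvPolynomial σ K) (x : σ → k) :
    MvPolynomial.eval x (mapCoeff l F) =
      l (MvPolynomial.eval (fun i => algebraMap k K (x i)) F) := by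
  rw [mapCoeff, map_sum, MvPolynomial.eval_eq, map_sum]
  refine Finset.sum_congr rfl fun s _ => ?_
  rw [MvPolynomial.eval_monomial, Finsupp.prod]
  have : F.coeff s * ∏ i ∈ s.support, algebraMap k K (x i) ^ s i =
      (∏ i ∈ s.support, x i ^ s i) • F.coeff s := by
    rw [Algebra.smul_def, map_prod, mul_comm]
    simp only [map_pow]
  rw [this, map_smul, smul_eq_mul, mul_comm]

/-- A nonzero polynomial over an extension field that vanishes on a set of rational points yields
a nonzero polynomial over the base field that vanishes there. -/
theorem exists_ne_zero_of_eval_eq_zero {F : MvPolynomial σ K} (hF : F ≠ 0) (T : Set (σ → k))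
    (h : ∀ x ∈ T, MvPolynomial.eval (fun i => algebraMap k K (x i)) F = 0) :
    ∃ H : MvPolynomial σ k, H ≠ 0 ∧ ∀ x ∈ T, MvPolynomial.eval x H = 0 := by
  obtain ⟨s, hs⟩ := MvPolynomial.ne_zero_iff.1 hF
  obtain ⟨l, hl⟩ : ∃ l : Module.Dual k K, l (F.coeff s) ≠ 0 := by
    by_contra! h0
    exact hs ((Module.forall_dual_apply_eq_zero_iff k _).1 h0)
  refine ⟨mapCoeff l F, fun h0 => hl ?_, fun x hx => ?_⟩
  · rw [← coeff_mapCoeff, h0, MvPolynomial.coeff_zero]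
  · rw [eval_mapCoeff, h x hx, map_zero]

/-- A polynomial over an extension field that vanishes on a set of rational points vanishes at all
common zeros of the polynomials over the base field vanishing on that set. -/
theorem eval_eq_zero_of_forall_eval_eq_zero (F : MvPolynomial σ K) (T : Set (σ → k))
    (h : ∀ x ∈ T, MvPolynomial.eval (fun i => algebraMap k K (x i)) F = 0) (y : σ → K)
    (hy : ∀ f : MvPolynomial σ k, (∀ x ∈ T, MvPolynomial.eval x f = 0) →
      MvPolynomial.aeval y f = 0) :
    MvPolynomial.eval y F = 0 := by
  classical
  -- Expanding the coefficients in a basis writes `F` as a combination of polynomials over `k`, each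
  -- of which vanishes on `T`.
  let b := Module.Basis.ofVectorSpace k K
  have hF : ∀ s ∈ F.support, F.coeff s =
      ∑ j ∈ F.support.biUnion fun s => (b.repr (F.coeff s)).support,
      b.coord j (F.coeff s) • b j := by
    intro s hs
    conv_lhs => rw [← b.linearCombination_repr (F.coeff s), Finsupp.linearCombination_apply]
    rw [Finsupp.sum_of_support_subset _ (Finset.subset_biUnion_of_mem
      (fun s => (b.repr (F.coeff s)).support) hs) _ (by simp)]
    rfl
  rw [MvPolynomial.eval_eq, Finset.sum_congr rfl fun s hs => by rw [hF s hs, Finset.sum_mul],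
    Finset.sum_comm]
  refine Finset.sum_eq_zero fun j _ => ?_
  have hj := hy (mapCoeff (b.coord j) F) fun x hx => by rw [eval_mapCoeff, h x hx, map_zero]
  rw [mapCoeff, map_sum] at hj
  rw [← mul_zero (b j), ← hj, Finset.mul_sum]
  refine Finset.sum_congr rfl fun s _ => ?_
  rw [MvPolynomial.aeval_monomial, Finsupp.prod, Algebra.smul_def]
  ring

end ExtensionOfScalars

/-! ### Reduction of polynomials over a valued field -/

section Residue

variable {U : Type*} [Field U] (O : ValuationSubring U)

/-- A nonzero polynomial over a valued field can be scaled so that it is integral with nonzero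
reduction. -/
theorem exists_integral_polynomial {σ : Type*} {F : MvPolynomial σ U} (hF : F ≠ 0) :
    ∃ F' : MvPolynomial σ O, F'.map (IsLocalRing.residue O) ≠ 0 ∧
      ∃ c : U, F'.map (algebraMap O U) = MvPolynomial.C c * F := by
  -- Dividing by a coefficient that is largest for the multiplicative valuation makes all
  -- coefficients integral and this one equal to `1`.
  obtain ⟨s₀, hs₀, hmax⟩ := F.support.exists_max_image (fun s => O.valuation (F.coeff s))
    (MvPolynomial.support_nonempty.2 hF)
  have hc : F.coeff s₀ ≠ 0 := MvPolynomial.mem_support_iff.1 hs₀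
  have hmem : ∀ s, (F.coeff s₀)⁻¹ * F.coeff s ∈ O := by
    intro s
    rw [← ValuationSubring.valuation_le_one_iff, map_mul, map_inv₀]
    by_cases hs : s ∈ F.support
    · exact (mul_le_mul_right (hmax s hs) _).trans_eq (inv_mul_cancel₀ (by simpa using hc))
    · rw [MvPolynomial.notMem_support_iff.1 hs]; simp
  have hr : MvPolynomial.C (F.coeff s₀)⁻¹ * F ∈
      Set.range (MvPolynomial.map (σ := σ) (algebraMap O U)) := by
    rw [MvPolynomial.mem_range_map_iff_coeffs_subset]
    intro x hx
    obtain ⟨s, -, rfl⟩ := MvPolynomial.mem_coeffs_iff.1 hx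
    rw [MvPolynomial.coeff_C_mul]
    exact ⟨⟨_, hmem s⟩, rfl⟩
  obtain ⟨F', hF'⟩ := hr
  refine ⟨F', fun h0 => ?_, _, hF'⟩
  have h1 : F'.coeff s₀ = 1 := by
    have := congrArg (MvPolynomial.coeff s₀) hF'
    rw [MvPolynomial.coeff_map, MvPolynomial.coeff_C_mul, inv_mul_cancel₀ hc] at this
    exact Subtype.ext this
  have := congrArg (MvPolynomial.coeff s₀) h0
  rw [MvPolynomial.coeff_map, h1, map_one, MvPolynomial.coeff_zero] at this
  exact one_ne_zero this

end Residue

/-! ### Krull dimension of subsets of the general linear group -/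

section ZariskiDimension

open TopologicalSpace

attribute [local instance] zariski

variable {k : Type u} [Field k] {m : ℕ}

theorem isOpen_eval_ne_zero (f : MvPolynomial (Fin m × Fin m) k) :
    IsOpen {g : GL (Fin m) k | MvPolynomial.eval (coords g) f ≠ 0} :=
  isOpen_generateFrom_of_mem ⟨f, rfl⟩

theorem isClosed_eval_eq_zero (f : MvPolynomial (Fin m × Fin m) k) :
    IsClosed {g : GL (Fin m) k | MvPolynomial.eval (coords g) f = 0} :=
  ⟨isOpen_eval_ne_zero f⟩

theorem exists_eval_ne_zero_of_mem_isOpen {V : Set (GL (Fin m) k)} (hV : IsOpen V)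
    {g : GL (Fin m) k} (hg : g ∈ V) : ∃ f : MvPolynomial (Fin m × Fin m) k,
      MvPolynomial.eval (coords g) f ≠ 0 ∧ ∀ x, MvPolynomial.eval (coords x) f ≠ 0 → x ∈ V := by
  have hB := isTopologicalBasis_of_subbasis_of_inter (t := zariski k m) rfl (by
    rintro _ ⟨f₁, rfl⟩ _ ⟨f₂, rfl⟩
    refine ⟨f₁ * f₂, ?_⟩
    ext x
    simp)
  obtain ⟨W, hW, hgW, hWV⟩ := hB.exists_subset_of_mem_open hg hV
  rcases hW with rfl | ⟨f, rfl⟩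
  · exact ⟨1, by simp, fun x _ => hWV trivial⟩
  · exact ⟨f, hgW, fun x hx => hWV hx⟩

theorem exists_eval_ne_zero_of_notMem_isClosed {S : Set (GL (Fin m) k)} {T : Set S}
    (hT : IsClosed T) {g : S} (hg : g ∉ T) : ∃ f : MvPolynomial (Fin m × Fin m) k,
      MvPolynomial.eval (coords g.1) f ≠ 0 ∧ ∀ x ∈ T, MvPolynomial.eval (coords x.1) f = 0 := by
  obtain ⟨V, hV, hVT⟩ := isOpen_induced_iff.1 hT.isOpen_compl
  have hgV : g.1 ∈ V := by
    have : g ∈ Subtype.val ⁻¹' V := hVT ▸ hg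
    exact this
  obtain ⟨f, hfg, hf⟩ := exists_eval_ne_zero_of_mem_isOpen hV hgV
  refine ⟨f, hfg, fun x hx => ?_⟩
  by_contra hne
  have : x ∈ Subtype.val ⁻¹' V := hf _ hne
  rw [hVT] at this
  exact this hx

/-- The ideal of the polynomials that vanish on a subset of a subset of `GL_m(k)`. -/
def vanishingIdealOn {S : Set (GL (Fin m) k)} (T : Set S) :
    Ideal (MvPolynomial (Fin m × Fin m) k) where
  carrier := {f | ∀ x ∈ T, MvPolynomial.eval (coords x.1) f = 0}
  zero_mem' := by simp
  add_mem' := by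
    intro f f' hf hf' x hx
    rw [map_add, hf x hx, hf' x hx, add_zero]
  smul_mem' := by
    intro c f hf x hx
    rw [smul_eq_mul, map_mul, hf x hx, mul_zero]

theorem vanishingIdealOn_isPrime {S : Set (GL (Fin m) k)} {T : Set S} (hT : IsIrreducible T) :
    (vanishingIdealOn T).IsPrime := by
  refine Ideal.isPrime_iff.2 ⟨fun h => ?_, fun {f f'} hff' => ?_⟩
  · obtain ⟨x, hx⟩ := hT.nonempty
    have : (1 : MvPolynomial (Fin m × Fin m) k) ∈ vanishingIdealOn T := h ▸ trivial
    simpa using this x hx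
  · by_contra! hne
    have key : ∀ f ∉ vanishingIdealOn T,
        (T ∩ {x : S | MvPolynomial.eval (coords x.1) f ≠ 0}).Nonempty := by
      intro f hf
      by_contra hempty
      refine hf fun x hx => ?_
      by_contra hfx
      exact hempty ⟨x, hx, hfx⟩
    obtain ⟨x, hxT, hx, hx'⟩ := hT.2 _ _
      ((isOpen_eval_ne_zero f).preimage continuous_subtype_val)
      ((isOpen_eval_ne_zero f').preimage continuous_subtype_val) (key f hne.1) (key f' hne.2)
    have := hff' x hxT
    rw [map_mul] at this
    exact mul_ne_zero hx hx' this

/-- The vanishing ideal of an irreducible closed set, as a point of the dual of the spectrum. -/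
def vanishingPrime {S : Set (GL (Fin m) k)} (T : IrreducibleCloseds S) :
    (PrimeSpectrum (MvPolynomial (Fin m × Fin m) k))ᵒᵈ :=
  OrderDual.toDual ⟨vanishingIdealOn (T : Set S), vanishingIdealOn_isPrime T.isIrreducible⟩

/-- A point outside a closed set is separated from it by a polynomial, so a closed set is determined
by its vanishing ideal. -/
theorem vanishingPrime_strictMono (S : Set (GL (Fin m) k)) :
    StrictMono (vanishingPrime (S := S)) := by
  refine Monotone.strictMono_of_injective (fun T T' h f hf x hx => hf x (h hx)) fun T T' h => ?_
  have h' : vanishingIdealOn (T : Set S) = vanishingIdealOn (T' : Set S) :=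
    congrArg (fun P => (OrderDual.ofDual P).asIdeal) h
  have key : ∀ T T' : IrreducibleCloseds S,
      vanishingIdealOn (T : Set S) = vanishingIdealOn (T' : Set S) → T ≤ T' := by
    intro T T' h x hx
    by_contra hne
    obtain ⟨f, hfx, hf⟩ := exists_eval_ne_zero_of_notMem_isClosed T'.isClosed hne
    have : f ∈ vanishingIdealOn (T' : Set S) := hf
    rw [← h] at this
    exact hfx (this x hx)
  exact le_antisymm (key _ _ h') (key _ _ h'.symm)

/-- The dimension of `S` is at most `n` if at most `n` polynomials can be algebraically independent
as functions on `S`. -/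
theorem zdim_le_of_forall {S : Set (GL (Fin m) k)} {n : ℕ}
    (h : ∀ (r : ℕ) (f : Fin r → MvPolynomial (Fin m × Fin m) k),
      (∀ H : MvPolynomial (Fin r) k,
        (∀ g ∈ S, MvPolynomial.eval (fun i => MvPolynomial.eval (coords g) (f i)) H = 0) → H = 0) →
      r ≤ n) : zdim S ≤ n := by
  refine iSup_le fun l => ?_
  set T := l.last
  set P := vanishingIdealOn (T : Set S)
  have hP : P.IsPrime := vanishingIdealOn_isPrime T.isIrreducible
  -- Lifts of the `d` normalizing variables are algebraically independent as functions on `T`, hence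
  -- on `S`, so `d ≤ n`.
  obtain ⟨d, g, hinj, -, hdim⟩ :=
    exists_noether_normalization k (MvPolynomial (Fin m × Fin m) k ⧸ P)
  choose f hf using fun i => Ideal.Quotient.mk_surjective (g (MvPolynomial.X i))
  have hdn : d ≤ n := by
    refine h d f fun H hH => ?_
    refine (injective_iff_map_eq_zero g).1 hinj H ?_
    have hg : g = (Ideal.Quotient.mkₐ k P).comp (MvPolynomial.aeval f) := by
      ext i
      simp [hf]
    rw [hg, AlgHom.comp_apply, Ideal.Quotient.mkₐ_eq_mk, Ideal.Quotient.eq_zero_iff_mem]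
    intro x _
    rw [← hH x.1 x.2, MvPolynomial.aeval_def, MvPolynomial.eval₂_comp_left
      (MvPolynomial.eval (coords x.1))]
    congr 1
    ext
    simp
  -- The chain below `T` gives a chain of primes above `P`, whose length is at most the dimension
  -- `d` of the quotient by `P`.
  have h1 : (l.length : ℕ∞) ≤ Order.height T := Order.length_le_height_last
  have h2 := h1.trans (Order.height_le_height_apply_of_strictMono _ (vanishingPrime_strictMono S) T)
  have h3 : Order.height (vanishingPrime T) =
    Order.coheight (OrderDual.ofDual (vanishingPrime T)) := rfl
  have h4 : ((l.length : ℕ∞) : WithBot ℕ∞) ≤ d := by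
    rw [← hdim, ringKrullDim_quotient]
    refine (WithBot.coe_le_coe.2 (h2.trans_eq h3)).trans ?_
    rw [Order.coheight_eq_krullDim_Ici]
    exact Order.krullDim_le_of_strictMono (fun Q => ⟨Q.1, Q.2⟩) fun _ _ hlt => hlt
  exact h4.trans (by exact_mod_cast hdn)

theorem zdim_mono {S T : Set (GL (Fin m) k)} (h : S ⊆ T) : zdim S ≤ zdim T :=
  (Topology.IsEmbedding.inclusion h).isInducing.topologicalKrullDim_le

variable {A : Type*} [CommRing A] [Algebra k A]

/-- The closed subset of `GL_m(k)` defined by the kernel of a homomorphism from the polynomial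
ring. -/
def kerZeros (α : MvPolynomial (Fin m × Fin m) k →ₐ[k] A) : Set (GL (Fin m) k) :=
  {g | ∀ f, α f = 0 → MvPolynomial.eval (coords g) f = 0}

/-- A homomorphism `A → k` yields a matrix over `k`; it is invertible because the determinant is
already a unit in `A`. -/
theorem exists_point_of_notMem_prime [IsAlgClosed k] [Algebra.FiniteType k A]
    {α : MvPolynomial (Fin m × Fin m) k →ₐ[k] A}
    (hdet : IsUnit (α (Matrix.mvPolynomialX (Fin m) (Fin m) k).det))
    (Q : Ideal A) [Q.IsPrime] {f : MvPolynomial (Fin m × Fin m) k} (hf : α f ∉ Q) :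
    ∃ g ∈ kerZeros α, (∀ f', α f' ∈ Q → MvPolynomial.eval (coords g) f' = 0) ∧
      MvPolynomial.eval (coords g) f ≠ 0 := by
  obtain ⟨φ, hφQ, hφf⟩ := exists_algHom_of_notMem_prime (k := k) Q hf
  let x : Fin m × Fin m → k := fun i => φ (α (MvPolynomial.X i))
  have hx : ∀ f, MvPolynomial.eval x f = φ (α f) := by
    intro f
    have : (MvPolynomial.aeval x : _ →ₐ[k] k) = φ.comp α := by ext i; simp [x]
    exact DFunLike.congr_fun this f
  have hu : IsUnit (Matrix.of fun i j => x (i, j)).det := by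
    have := hx (Matrix.mvPolynomialX (Fin m) (Fin m) k).det
    rw [Matrix.eval_det_mvPolynomialX] at this
    exact this ▸ hdet.map φ
  let g : GL (Fin m) k := Matrix.GeneralLinearGroup.mk'' _ hu
  have hg : coords g = x := rfl
  refine ⟨g, fun f' hf' => ?_, fun f' hf' => ?_, ?_⟩
  · rw [hg, hx, hf', map_zero]
  · rw [hg, hx, hφQ _ hf']
  · rw [hg, hx]; exact hφf

/-- The irreducible closed subset of `kerZeros α` that corresponds to a prime ideal. -/
def primeZeros [IsAlgClosed k] [Algebra.FiniteType k A]
    {α : MvPolynomial (Fin m × Fin m) k →ₐ[k] A}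
    (hdet : IsUnit (α (Matrix.mvPolynomialX (Fin m) (Fin m) k).det)) (Q : PrimeSpectrum A) :
    IrreducibleCloseds (kerZeros α) where
  carrier := {g | ∀ f, α f ∈ Q.asIdeal → MvPolynomial.eval (coords g.1) f = 0}
  isIrreducible' := by
    constructor
    · obtain ⟨g, hg, hgQ, -⟩ := exists_point_of_notMem_prime hdet Q.asIdeal (f := 1)
        (by rw [map_one]; exact fun h => Q.2.ne_top ((Ideal.eq_top_iff_one _).2 h))
      exact ⟨⟨g, hg⟩, hgQ⟩
    · intro V V' hV hV' h h'
      have key : ∀ V : Set (kerZeros α), IsOpen V →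
          ({g : kerZeros α | ∀ f, α f ∈ Q.asIdeal → MvPolynomial.eval (coords g.1) f = 0} ∩
            V).Nonempty →
          ∃ f, α f ∉ Q.asIdeal ∧
            ∀ x : kerZeros α, MvPolynomial.eval (coords x.1) f ≠ 0 → x ∈ V := by
        rintro _ hV ⟨g, hgQ, hgV⟩
        obtain ⟨W, hW, rfl⟩ := isOpen_induced_iff.1 hV
        obtain ⟨f, hfg, hf⟩ := exists_eval_ne_zero_of_mem_isOpen hW hgV
        exact ⟨f, fun hfQ => hfg (hgQ f hfQ), fun x hx => hf x.1 hx⟩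
      obtain ⟨f, hfQ, hf⟩ := key V hV h
      obtain ⟨f', hfQ', hf'⟩ := key V' hV' h'
      obtain ⟨g, hg, hgQ, hgf⟩ := exists_point_of_notMem_prime hdet Q.asIdeal (f := f * f')
        (by rw [map_mul]; exact fun h => (Q.2.mem_or_mem h).elim hfQ hfQ')
      rw [map_mul] at hgf
      exact ⟨⟨g, hg⟩, hgQ, hf _ (left_ne_zero_of_mul hgf), hf' _ (right_ne_zero_of_mul hgf)⟩
  isClosed' := by
    simp only [Set.ofPred_forall]
    exact isClosed_iInter fun f => isClosed_iInter fun _ =>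
      (isClosed_eval_eq_zero f).preimage continuous_subtype_val

/-- Up to units, every element of `A` is the image of a polynomial, so a prime is determined by the
polynomials mapping into it, and by the Nullstellensatz these are determined by its zero set. -/
theorem ringKrullDim_le_zdim [IsAlgClosed k] [Algebra.FiniteType k A]
    {α : MvPolynomial (Fin m × Fin m) k →ₐ[k] A}
    (hdet : IsUnit (α (Matrix.mvPolynomialX (Fin m) (Fin m) k).det))
    (hα : ∀ x : A, ∃ f w, IsUnit w ∧ x * w = α f) : ringKrullDim A ≤ zdim (kerZeros α) := by
  have key : ∀ Q Q' : PrimeSpectrum A, primeZeros hdet Q ≤ primeZeros hdet Q' → Q' ≤ Q := by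
    intro Q Q' h x hx
    obtain ⟨f, w, hw, hf⟩ := hα x
    have hfQ : α f ∈ Q'.asIdeal := hf ▸ Ideal.mul_mem_right _ _ hx
    by_contra hne
    have hfQ' : α f ∉ Q.asIdeal := by
      rw [← hf]
      exact fun h => (Q.2.mem_or_mem h).elim hne fun h =>
        Q.2.ne_top (Ideal.eq_top_of_isUnit_mem _ h hw)
    obtain ⟨g, hg, hgQ, hgf⟩ := exists_point_of_notMem_prime hdet Q.asIdeal hfQ'
    exact hgf (h (show (⟨g, hg⟩ : kerZeros α) ∈ primeZeros hdet Q from hgQ) f hfQ)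
  rw [zdim, topologicalKrullDim, ← Order.krullDim_orderDual]
  refine Order.krullDim_le_of_strictMono (fun Q => OrderDual.toDual (primeZeros hdet Q)) ?_
  intro Q Q' h
  exact lt_of_le_not_ge (fun g hg f hf => hg f (h.le hf)) fun hle => h.not_ge (key _ _ hle)

end ZariskiDimension

/-! ### The group of `U`-points of `G` -/

section Points

variable {k : Type u} [Field k] {m : ℕ} (G : Subgroup (GL (Fin m) k))
  {U : Type v} [Field U] [Algebra k U]

theorem coords_injective {F : Type*} [Field F] {m : ℕ} :
    Function.Injective (coords : GL (Fin m) F → Fin m × Fin m → F) := fun g h hgh => by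
  ext i j
  exact congrFun hgh (i, j)

theorem aeval_coords_incl (h : GL (Fin m) k) (f : MvPolynomial (Fin m × Fin m) k) :
    MvPolynomial.aeval (coords (incl k m U h)) f =
      algebraMap k U (MvPolynomial.eval (coords h) f) :=
  MvPolynomial.aeval_algebraMap_apply U (coords h) f

theorem incl_mem_points {h : GL (Fin m) k} (hh : h ∈ G) : incl k m U h ∈ points G U := by
  intro f hf
  rw [aeval_coords_incl, hf h hh, map_zero]

/-- Density of `G(k)` in the `U`-points, even for polynomials over `U`. This allows the group laws
to be checked by translating by one `U`-point at a time. -/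
theorem eval_eq_zero_of_mem_points (F : MvPolynomial (Fin m × Fin m) U)
    (h : ∀ x ∈ G, MvPolynomial.eval (coords (incl k m U x)) F = 0) {y : GL (Fin m) U}
    (hy : y ∈ points G U) : MvPolynomial.eval (coords y) F = 0 := by
  refine eval_eq_zero_of_forall_eval_eq_zero F (coords '' (G : Set (GL (Fin m) k))) ?_ _ ?_
  · rintro _ ⟨x, hx, rfl⟩
    exact h x hx
  · exact fun f hf => hy f fun x hx => hf _ ⟨x, hx, rfl⟩

/-- The polynomial `f(a x b)`. -/
noncomputable def translate (a b : Matrix (Fin m) (Fin m) U)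
    (f : MvPolynomial (Fin m × Fin m) k) : MvPolynomial (Fin m × Fin m) U :=
  MvPolynomial.aeval (fun ij : Fin m × Fin m =>
    (a.map MvPolynomial.C * Matrix.mvPolynomialX (Fin m) (Fin m) U * b.map MvPolynomial.C :
      Matrix _ _ _) ij.1 ij.2) f

theorem eval_translate (a b : Matrix (Fin m) (Fin m) U) (y : Matrix (Fin m) (Fin m) U)
    (f : MvPolynomial (Fin m × Fin m) k) :
    MvPolynomial.eval (fun ij => y ij.1 ij.2) (translate a b f) =
      MvPolynomial.aeval (fun ij : Fin m × Fin m => (a * y * b) ij.1 ij.2) f := by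
  have h : ((MvPolynomial.aeval (fun ij : Fin m × Fin m => y ij.1 ij.2) :
      MvPolynomial (Fin m × Fin m) U →ₐ[U] U).restrictScalars k).comp
      (MvPolynomial.aeval (fun ij : Fin m × Fin m =>
        (a.map MvPolynomial.C * Matrix.mvPolynomialX (Fin m) (Fin m) U *
          b.map MvPolynomial.C : Matrix _ _ _) ij.1 ij.2)) =
      MvPolynomial.aeval (fun ij : Fin m × Fin m => (a * y * b) ij.1 ij.2) := by
    ext ij
    simp [Matrix.mul_apply, Matrix.mvPolynomialX_apply]
  exact DFunLike.congr_fun h f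

theorem eval_coords_translate (a b y : GL (Fin m) U) (f : MvPolynomial (Fin m × Fin m) k) :
    MvPolynomial.eval (coords y) (translate a.val b.val f) =
      MvPolynomial.aeval (coords (a * y * b)) f :=
  eval_translate a.val b.val y.val f

theorem mul_mem_points {x y : GL (Fin m) U} (hx : x ∈ points G U) (hy : y ∈ points G U) :
    x * y ∈ points G U := by
  intro f hf
  -- Density is used twice: first in the right factor with the left one rational, then in the left
  -- factor with `y` fixed.
  have h1 : ∀ h ∈ G, MvPolynomial.aeval (coords (incl k m U h * y)) f = 0 := by
    intro h hh
    have := eval_eq_zero_of_mem_points G (translate (incl k m U h).val (1 : GL (Fin m) U).val f)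
      (fun x hx => by
        rw [eval_coords_translate, mul_one, ← map_mul, aeval_coords_incl, hf _ (mul_mem hh hx),
          map_zero]) hy
    rwa [eval_coords_translate, mul_one] at this
  have := eval_eq_zero_of_mem_points G (translate (1 : GL (Fin m) U).val y.val f)
    (fun x hx => by rw [eval_coords_translate, one_mul, h1 x hx]) hx
  rwa [eval_coords_translate, one_mul] at this

/-- By Cramer's rule the entries of `x⁻¹` are polynomials divided by the determinant, whose powers
clear the denominators. -/
theorem exists_eval_inv (U : Type v) [Field U] [Algebra k U]
    (f : MvPolynomial (Fin m × Fin m) k) :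
    ∃ (N : ℕ) (g : MvPolynomial (Fin m × Fin m) k), ∀ x : GL (Fin m) U,
      MvPolynomial.aeval (coords x) g = x.val.det ^ N * MvPolynomial.aeval (coords x⁻¹) f := by
  induction f using MvPolynomial.induction_on with
  | C c => exact ⟨0, MvPolynomial.C c, fun x => by simp⟩
  | add f f' ih ih' =>
    obtain ⟨N, g, hg⟩ := ih
    obtain ⟨N', g', hg'⟩ := ih'
    let D := (Matrix.mvPolynomialX (Fin m) (Fin m) k).det
    have hD : ∀ x : GL (Fin m) U, MvPolynomial.aeval (coords x) D = x.val.det := fun x => by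
      rw [← AlgHom.coe_toRingHom, RingHom.map_det]
      exact congrArg _ (Matrix.mvPolynomialX_mapMatrix_aeval k x.val)
    refine ⟨N + N', D ^ N' * g + D ^ N * g', fun x => ?_⟩
    rw [map_add, map_mul, map_mul, map_pow, map_pow, hD, hg, hg', map_add]
    ring
  | mul_X f i ih =>
    obtain ⟨N, g, hg⟩ := ih
    refine ⟨N + 1, g * (Matrix.mvPolynomialX (Fin m) (Fin m) k).adjugate i.1 i.2, fun x => ?_⟩
    have hadj : MvPolynomial.aeval (coords x)
        ((Matrix.mvPolynomialX (Fin m) (Fin m) k).adjugate i.1 i.2) = x.val.adjugate i.1 i.2 := by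
      have := AlgHom.map_adjugate (MvPolynomial.aeval (coords x) : _ →ₐ[k] U)
        (Matrix.mvPolynomialX (Fin m) (Fin m) k)
      rw [show (MvPolynomial.aeval (coords x) : _ →ₐ[k] U).mapMatrix
        (Matrix.mvPolynomialX (Fin m) (Fin m) k) = x.val from
        Matrix.mvPolynomialX_mapMatrix_aeval k x.val] at this
      exact congrFun (congrFun this i.1) i.2
    have hinv : x.val.adjugate i.1 i.2 = x.val.det * coords x⁻¹ i := by
      have hdet : x.val.det ≠ 0 := ((Matrix.isUnit_iff_isUnit_det _).1 x.isUnit).ne_zero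
      rw [coords, Matrix.coe_units_inv, Matrix.inv_def, Matrix.smul_apply, smul_eq_mul,
        Ring.inverse_eq_inv', mul_inv_cancel_left₀ hdet]
    rw [map_mul, hg, hadj, hinv, map_mul, MvPolynomial.aeval_X]
    ring

theorem inv_mem_points {x : GL (Fin m) U} (hx : x ∈ points G U) : x⁻¹ ∈ points G U := by
  intro f hf
  obtain ⟨N, g, hg⟩ := exists_eval_inv U f
  have hdet : x.val.det ≠ 0 := ((Matrix.isUnit_iff_isUnit_det _).1 x.isUnit).ne_zero
  have h0 : MvPolynomial.aeval (coords x) g = 0 := by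
    refine hx g fun h hh => (algebraMap k U).injective ?_
    rw [← aeval_coords_incl, hg, ← map_inv, aeval_coords_incl, hf _ (inv_mem hh), map_zero,
      mul_zero]
  rw [hg] at h0
  exact (mul_eq_zero.1 h0).resolve_left (pow_ne_zero _ hdet)

variable (U) in
/-- The group of `U`-points of `G`. -/
def pointsSubgroup : Subgroup (GL (Fin m) U) where
  carrier := points G U
  mul_mem' := mul_mem_points G
  one_mem' := by
    rw [← map_one (incl k m U)]
    exact incl_mem_points G (one_mem G)
  inv_mem' := inv_mem_points G

end Points

/-! ### The infinitesimal subgroup -/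

section Infinitesimals

variable {U : Type v} [Field U]

/-- The congruence subgroup of `GL_m(U)`: the integral invertible matrices with residue `1`. -/
def congruenceSubgroup (O : ValuationSubring U) (m : ℕ) : Subgroup (GL (Fin m) U) :=
  (Matrix.GeneralLinearGroup.map (n := Fin m) (IsLocalRing.residue O)).ker.map
    (Matrix.GeneralLinearGroup.map (algebraMap O U))

theorem residue_eq_residue_iff {O : ValuationSubring U} (x y : O) :
    IsLocalRing.residue O x = IsLocalRing.residue O y ↔ O.valuation ((x : U) - y) < 1 := by
  rw [← sub_eq_zero, ← map_sub, IsLocalRing.residue_eq_zero_iff]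
  exact ValuationSubring.valuation_lt_one_iff O (x - y)

theorem one_apply_coe (O : ValuationSubring U) {m : ℕ} (i j : Fin m) :
    (((1 : Matrix (Fin m) (Fin m) O) i j : O) : U) = (1 : Matrix (Fin m) (Fin m) U) i j := by
  simp only [Matrix.one_apply]
  split_ifs <;> rfl

/-- The determinant has residue `1`, hence is a unit of the local ring `O`, so invertibility is
automatic. -/
theorem exists_mem_congruenceSubgroup {O : ValuationSubring U} {m : ℕ}
    {M : Matrix (Fin m) (Fin m) U}
    (h : ∀ i j, O.valuation (M i j - (1 : Matrix (Fin m) (Fin m) U) i j) < 1) :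
    ∃ e ∈ congruenceSubgroup O m, e.val = M := by
  have hM : ∀ i j, M i j ∈ O := by
    intro i j
    rw [← sub_add_cancel (M i j) ((1 : Matrix (Fin m) (Fin m) U) i j)]
    refine add_mem ((ValuationSubring.valuation_le_one_iff _ _).1 (h i j).le) ?_
    rw [← one_apply_coe O]
    exact Subtype.coe_prop _
  let E : Matrix (Fin m) (Fin m) O := fun i j => ⟨M i j, hM i j⟩
  have hE : E.map (IsLocalRing.residue O) = 1 := by
    ext i j
    rw [← Matrix.map_one (IsLocalRing.residue O) (map_zero _) (map_one _), Matrix.map_apply,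
      Matrix.map_apply, residue_eq_residue_iff, one_apply_coe]
    exact h i j
  have hdet : IsUnit E.det := by
    refine isUnit_of_map_unit (IsLocalRing.residue O) _ ?_
    rw [RingHom.map_det, RingHom.mapMatrix_apply, hE, Matrix.det_one]
    exact isUnit_one
  refine ⟨_, ⟨Matrix.GeneralLinearGroup.mk'' E hdet, ?_, rfl⟩, ?_⟩
  · exact Units.ext hE
  · ext i j
    rfl

theorem valuation_sub_lt_one_of_mem_congruenceSubgroup {O : ValuationSubring U} {m : ℕ}
    {e : GL (Fin m) U} (he : e ∈ congruenceSubgroup O m) (i j : Fin m) :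
    O.valuation (e.val i j - (1 : Matrix (Fin m) (Fin m) U) i j) < 1 := by
  obtain ⟨E, hE, rfl⟩ := he
  have h1 : IsLocalRing.residue O (E.val i j) =
      IsLocalRing.residue O ((1 : Matrix (Fin m) (Fin m) O) i j) := by
    have := congrArg (fun g => g.val i j) (MonoidHom.mem_ker.1 hE)
    refine this.trans ?_
    rw [← Matrix.map_apply (f := IsLocalRing.residue O), Matrix.map_one _ (map_zero _) (map_one _)]
    rfl
  rw [residue_eq_residue_iff, one_apply_coe] at h1
  exact h1

theorem mem_congruenceSubgroup_iff {O : ValuationSubring U} {m : ℕ} {e : GL (Fin m) U} :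
    e ∈ congruenceSubgroup O m ↔
      ∀ i j, O.valuation (e.val i j - (1 : Matrix (Fin m) (Fin m) U) i j) < 1 := by
  refine ⟨valuation_sub_lt_one_of_mem_congruenceSubgroup, fun h => ?_⟩
  obtain ⟨e', he', h'⟩ := exists_mem_congruenceSubgroup h
  rwa [← Units.ext h']

theorem map_mem_of_mem_congruenceSubgroup {O : ValuationSubring U} {m : ℕ} {e : GL (Fin m) U}
    (he : e ∈ congruenceSubgroup O m) (i j : Fin m) : e.val i j ∈ O := by
  obtain ⟨E, -, rfl⟩ := he
  exact (E.val i j).2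

variable {k : Type u} [Field k] [Algebra k U] [LocModel k U]

theorem algebraMap_mem_O (c : k) : algebraMap k U c ∈ LocModel.O k (U := U) :=
  LocModel.RES_le _ (LocModel.algebraMap_mem c)

variable (k U) in
/-- The inclusion of `k` in the valuation ring. -/
def toO : k →+* LocModel.O k (U := U) :=
  (algebraMap k U).codRestrict (LocModel.O k (U := U)) algebraMap_mem_O

theorem res_eq_iff {x c : U} (hx : x ∈ LocModel.O k (U := U)) (hc : c ∈ LocModel.RES k (U := U)) :
    res k x = c ↔ (LocModel.O k (U := U)).valuation (x - c) < 1 := by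
  have h : x / 1 ∈ LocModel.O k (U := U) ∧ (1 : U) ≠ 0 := ⟨by rwa [div_one], one_ne_zero⟩
  obtain ⟨h1, h2⟩ := (LocModel.exists_res (k := k) (x / 1) h.1).choose_spec
  have h3 : res k x = (LocModel.exists_res (k := k) (x / 1) h.1).choose := by
    rw [res, res₂, dif_pos h]
  rw [← h3] at h1 h2
  rw [div_one] at h2
  exact ⟨fun h => h ▸ h2, fun h => res_unique k h1 hc h2 h⟩

theorem mem_mu_iff {m : ℕ} {G : Subgroup (GL (Fin m) k)} {e : GL (Fin m) U} :
    e ∈ mu G U ↔ e ∈ points G U ∧ e ∈ congruenceSubgroup (LocModel.O k (U := U)) m := by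
  have hone : ∀ i j, (1 : Matrix (Fin m) (Fin m) U) i j ∈ LocModel.RES k (U := U) := by
    intro i j
    rw [Matrix.one_apply]
    split_ifs
    exacts [one_mem _, zero_mem _]
  constructor
  · rintro ⟨⟨h1, h2, -⟩, h3⟩
    exact ⟨h1, mem_congruenceSubgroup_iff.2 fun i j => (res_eq_iff (h2 i j) (hone i j)).1 (h3 i j)⟩
  · rintro ⟨h1, h2⟩
    exact ⟨⟨h1, map_mem_of_mem_congruenceSubgroup h2,
      map_mem_of_mem_congruenceSubgroup (inv_mem h2)⟩, fun i j =>
      (res_eq_iff (map_mem_of_mem_congruenceSubgroup h2 i j) (hone i j)).2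
        (mem_congruenceSubgroup_iff.1 h2 i j)⟩

variable (U) in
/-- `mu`, as a subgroup. -/
def muSubgroup {m : ℕ} (G : Subgroup (GL (Fin m) k)) : Subgroup (GL (Fin m) U) :=
  pointsSubgroup G U ⊓ congruenceSubgroup (LocModel.O k (U := U)) m

theorem mem_mu_iff_mem_muSubgroup {m : ℕ} {G : Subgroup (GL (Fin m) k)} {e : GL (Fin m) U} :
    e ∈ mu G U ↔ e ∈ muSubgroup U G :=
  mem_mu_iff

/-- Since `k ⊆ O`, the matrix `h` is a point of `GL_m(O)`, where the kernel of reduction is normal.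
-/
theorem conj_mem_muSubgroup {m : ℕ} {G : Subgroup (GL (Fin m) k)} {h : GL (Fin m) k} (hh : h ∈ G)
    {e : GL (Fin m) U} (he : e ∈ muSubgroup U G) :
    incl k m U h * e * (incl k m U h)⁻¹ ∈ muSubgroup U G := by
  have hp : incl k m U h ∈ pointsSubgroup G U := incl_mem_points G hh
  refine ⟨mul_mem (mul_mem hp he.1) (Subgroup.inv_mem _ hp), ?_⟩
  obtain ⟨E, hE, rfl⟩ := he.2
  let H := Matrix.GeneralLinearGroup.map (n := Fin m) (toO U k) h
  have hH : Matrix.GeneralLinearGroup.map (algebraMap (LocModel.O k (U := U)) U) H =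
      incl k m U h := rfl
  exact ⟨H * E * H⁻¹, (MonoidHom.normal_ker _).conj_mem E hE H, by
    rw [map_mul, map_mul, map_inv, hH]⟩

end Infinitesimals

/-! ### Basic definable sets -/

section Definability

open FirstOrder.Language

variable {k : Type u} {U : Type v} [Field k] [Field U] [Algebra k U] [LocModel k U]

theorem exists_term_realize {α : Type*} (f : MvPolynomial α k) :
    ∃ t : (valLang k).Term α, ∀ v : α → U, t.realize v = MvPolynomial.aeval v f := by
  induction f using MvPolynomial.induction_on with
  | C c =>
    refine ⟨Term.func (ValFunctions.const c) ![], fun v => ?_⟩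
    rw [MvPolynomial.aeval_C]
    rfl
  | add f g hf hg =>
    obtain ⟨s, hs⟩ := hf
    obtain ⟨t, ht⟩ := hg
    refine ⟨Term.func ValFunctions.add ![s, t], fun v => ?_⟩
    rw [map_add, ← hs, ← ht]
    rfl
  | mul_X f i hf =>
    obtain ⟨s, hs⟩ := hf
    refine ⟨Term.func ValFunctions.mul ![s, Term.var i], fun v => ?_⟩
    rw [map_mul, MvPolynomial.aeval_X, ← hs]
    rfl

theorem definableFun_aeval {α : Type*} (f : MvPolynomial α k) :
    (∅ : Set U).DefinableFun (valLang k) fun v : α → U => MvPolynomial.aeval v f := by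
  obtain ⟨t, ht⟩ := exists_term_realize (U := U) f
  simp only [← ht]
  exact t.definableFun_realize

theorem definable_aeval_eq {α : Type*} (f g : MvPolynomial α k) :
    (∅ : Set U).Definable (valLang k)
      {v : α → U | MvPolynomial.aeval v f = MvPolynomial.aeval v g} :=
  (definableFun_aeval f).ofPred_eq (definableFun_aeval g)

theorem definable_valuation_lt_one {α : Type*} (f : MvPolynomial α k) :
    (∅ : Set U).Definable (valLang k)
      {v : α → U | (LocModel.O k (U := U)).valuation (MvPolynomial.aeval v f) < 1} := by
  obtain ⟨t, ht⟩ := exists_term_realize (U := U) f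
  obtain ⟨s, hs⟩ := exists_term_realize (U := U) (1 : MvPolynomial α k)
  rw [Set.empty_definable_iff]
  let R : (valLang k).Relations 2 := ValRelations.valLE
  refine ⟨(Relations.formula R ![t, s]).not, ?_⟩
  ext v
  have h : (Relations.formula R ![t, s]).Realize v ↔
      (LocModel.O k (U := U)).valuation (s.realize v) ≤
        (LocModel.O k (U := U)).valuation (t.realize v) := Formula.realize_rel
  rw [Set.mem_ofPred, Set.mem_ofPred, Formula.realize_not, h, hs, ht, map_one, map_one, not_le]

theorem definable_realize {α : Type*} (ψ : (valLang k).Formula α) :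
    (∅ : Set U).Definable (valLang k) {v : α → U | ψ.Realize v} :=
  Set.empty_definable_iff.2 ⟨ψ, rfl⟩

theorem definable_loc {α : Type*} {X : Set (α → U)} (hX : (∅ : Set U).Definable (valLang k) X) :
    (∅ : Set U).Definable (locLang k) X :=
  hX.map_expansion (LHom.sumInl : valLang k →ᴸ locLang k)

end Definability

/-! ### Complete types and saturation -/

section CompleteTypes

open FirstOrder.Language

variable {k : Type u} {U : Type v} [Field k] [Field U] [Algebra k U] [LocModel k U]
  {ι : Type} {p : TypesOver k U ι}

/-- The existential closure of `ψ` holds in a model of the complete theory of `U`, hence in `U`; no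
saturation is needed. -/
theorem exists_realize_of_contains [Finite ι] {ψ : (valLang k).Formula ι} (h : Contains p ψ) :
    ∃ x : ι → U, ψ.Realize x := by
  obtain ⟨M, v, rfl⟩ := Theory.exists_modelType_is_realized_in _ p
  have hv : ψ.Realize v := Theory.CompleteType.formula_mem_typeOf.1 h
  let χ : (valLang k).Formula (Empty ⊕ ι) := ψ.relabel Sum.inr
  let σ : (valLang k).Sentence := Formula.iExs ι χ
  have hσ : M ⊨ σ := by
    refine (Formula.realize_iExs (φ := χ)).2 ⟨v, ?_⟩
    rw [Formula.realize_relabel]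
    exact hv
  have hU : U ⊨ σ := by
    by_contra hne
    have hnot : σ.not ∈ (valLang k).completeTheory U := by
      rw [mem_completeTheory, Sentence.realize_not]
      exact hne
    have := Theory.realize_sentence_of_mem (M := M) _ hnot
    rw [Sentence.realize_not] at this
    exact this hσ
  obtain ⟨x, hx⟩ := (Formula.realize_iExs (φ := χ)).1 hU
  rw [Formula.realize_relabel] at hx
  exact ⟨x, hx⟩

theorem contains_or_not (p : TypesOver k U ι) (ψ : (valLang k).Formula ι) :
    Contains p ψ ∨ Contains p ψ.not :=
  p.mem_or_not_mem _

theorem contains_inf {ψ φ : (valLang k).Formula ι} (h : Contains p ψ) (h' : Contains p φ) :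
    Contains p (ψ ⊓ φ) := by
  have : p ∈ ((valLang k).completeTheory U).typesWith
      (Formula.equivSentence ψ ⊓ Formula.equivSentence φ) := by
    rw [Theory.CompleteType.typesWith_inf]
    exact ⟨h, h'⟩
  exact this

theorem contains_top [Finite ι] (p : TypesOver k U ι) : Contains p ⊤ := by
  refine (contains_or_not p ⊤).resolve_right fun hn => ?_
  obtain ⟨x, hx⟩ := exists_realize_of_contains hn
  simp at hx

/-- The tuple `x` realizes the type `p`. -/
def Realizes (p : TypesOver k U ι) (x : ι → U) : Prop :=
  ∀ ψ, Contains p ψ → ψ.Realize x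

theorem Realizes.contains_iff {x : ι → U} (hx : Realizes p x) (ψ : (valLang k).Formula ι) :
    Contains p ψ ↔ ψ.Realize x := by
  refine ⟨hx ψ, fun h => (contains_or_not p ψ).resolve_right fun hn => ?_⟩
  have := hx _ hn
  rw [Formula.realize_not] at this
  exact this h

/-- Saturation: a relation over finitely many parameters that is compatible with every formula of a
type is compatible with some realization. -/
theorem exists_realizes_of_forall [Infinite k] [Finite ι] (hU : IsMonster k U) {κ : Type} [Finite κ]
    {R : Set (κ ⊕ ι → U)} (hR : (∅ : Set U).Definable (valLang k) R) (c : κ → U)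
    (h : ∀ ψ, Contains p ψ → ∃ x, ψ.Realize x ∧ Sum.elim c x ∈ R) :
    ∃ x, Realizes p x ∧ Sum.elim c x ∈ R := by
  let D : (valLang k).Formula ι → Set (ι → U) := fun ψ => {x | ψ.Realize x} ∩ {x | Sum.elim c x ∈ R}
  -- The finite set of parameters is within the saturation bound because `k` is infinite.
  have hA : Cardinal.lift.{u} (Cardinal.mk (Set.range c)) ≤ Cardinal.lift.{v} (Cardinal.mk k) :=
    (Cardinal.lift_le_aleph0.2 (Cardinal.mk_le_aleph0)).trans
      (Cardinal.aleph0_le_lift.2 (Cardinal.aleph0_le_mk k))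
  have hdef : ∀ ψ, (Set.range c).Definable (locLang k) (D ψ) := by
    intro ψ
    refine ((definable_loc (definable_realize ψ)).mono (Set.empty_subset _)).inter ?_
    refine Set.Definable.preimage_map (F := fun x : ι → U => Sum.elim c x) ?_
      ((definable_loc hR).mono (Set.empty_subset _))
    rintro (i | i)
    · exact Language.definableFun_const (locLang k) ι (Set.mem_range_self i)
    · exact Set.DefinableFun.proj (locLang k)
  obtain ⟨x, hx⟩ := hU (Set.range c) hA ι {X | ∃ ψ, Contains p ψ ∧ X = D ψ}
    (by rintro _ ⟨ψ, -, rfl⟩; exact hdef ψ) (by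
      intro F hF hfin
      have key : ∃ ψ, Contains p ψ ∧ D ψ ⊆ ⋂₀ F := by
        induction F, hfin using Set.Finite.induction_on with
        | empty => exact ⟨⊤, contains_top p, by simp⟩
        | @insert X F _ _ ih =>
          obtain ⟨ψ, hψ, hψF⟩ := ih fun Y hY => hF (Set.mem_insert_of_mem _ hY)
          obtain ⟨φ, hφ, rfl⟩ := hF (Set.mem_insert _ _)
          refine ⟨φ ⊓ ψ, contains_inf hφ hψ, fun x hx => ?_⟩
          have hx' := Formula.realize_inf.1 hx.1
          rw [Set.sInter_insert]
          exact ⟨⟨hx'.1, hx.2⟩, hψF ⟨hx'.2, hx.2⟩⟩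
      obtain ⟨ψ, hψ, hψF⟩ := key
      obtain ⟨x, hx⟩ := h ψ hψ
      exact ⟨x, hψF hx⟩)
  exact ⟨x, fun ψ hψ => (hx _ ⟨ψ, hψ, rfl⟩).1, (hx _ ⟨⊤, contains_top p, rfl⟩).2⟩

theorem exists_realizes [Infinite k] [Finite ι] (hU : IsMonster k U) (p : TypesOver k U ι) :
    ∃ x, Realizes p x := by
  obtain ⟨x, hx, -⟩ := exists_realizes_of_forall (p := p) hU (κ := Empty)
    (R := Set.univ) Set.definable_univ Empty.elim fun ψ hψ => by
      obtain ⟨x, hx⟩ := exists_realize_of_contains hψ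
      exact ⟨x, hx, trivial⟩
  exact ⟨x, hx⟩

end CompleteTypes

/-! ### The partial type `μ · p` and its stabilizer -/

section Tube

open FirstOrder.Language

variable {k : Type u} [Field k] {m : ℕ} {G : Subgroup (GL (Fin m) k)}
  {U : Type v} [Field U] [Algebra k U] [LocModel k U]

theorem exists_finset_points (G : Subgroup (GL (Fin m) k)) (U : Type v) [Field U] [Algebra k U] :
    ∃ s : Finset (MvPolynomial (Fin m × Fin m) k), ∀ g : GL (Fin m) U,
      g ∈ points G U ↔ ∀ f ∈ s, MvPolynomial.aeval (coords g) f = 0 := by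
  let I : Ideal (MvPolynomial (Fin m × Fin m) k) :=
    vanishingIdealOn (S := (G : Set (GL (Fin m) k))) Set.univ
  obtain ⟨s, hs⟩ := IsNoetherian.noetherian I
  refine ⟨s, fun g => ⟨fun hg f hf => ?_, fun hg f hf => ?_⟩⟩
  · have : f ∈ I := hs ▸ Submodule.subset_span hf
    exact hg f fun x hx => this ⟨x, hx⟩ trivial
  · have hfI : f ∈ I := fun x _ => hf x.1 x.2
    have hle : I ≤ RingHom.ker (MvPolynomial.aeval (coords g) : _ →ₐ[k] U) := by
      rw [← hs]
      exact Ideal.span_le.2 fun f hf => hg f hf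
    exact hle hfI

variable (G U) in
/-- The relation `x ∈ mu · y` between tuples. -/
def muRel : Set ((Fin m × Fin m) ⊕ (Fin m × Fin m) → U) :=
  {v | ∃ e ∈ mu G U, ∀ i j, v (Sum.inl (i, j)) = ∑ l, e.val i l * v (Sum.inr (l, j))}

variable (G U) in
-- Having residue `1` is a valuation inequality, so neither `res` nor `RES` is needed and the
-- relation is definable in the language of `p` itself. Finitely many equations suffice for `G`, and
-- the element of `μ` is quantified out.
theorem definable_muRel : (∅ : Set U).Definable (valLang k) (muRel G U) := by
  obtain ⟨s, hs⟩ := exists_finset_points G U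
  let ι := Fin m × Fin m
  let S₁ : Set ((ι ⊕ ι) ⊕ ι → U) :=
    ⋂ f : s, {w | MvPolynomial.aeval w (MvPolynomial.rename Sum.inr f.1) =
      MvPolynomial.aeval w (0 : MvPolynomial ((ι ⊕ ι) ⊕ ι) k)}
  let S₂ : Set ((ι ⊕ ι) ⊕ ι → U) :=
    ⋂ ij : ι, {w | (LocModel.O k (U := U)).valuation (MvPolynomial.aeval w
      (MvPolynomial.X (Sum.inr ij) - MvPolynomial.C ((1 : Matrix (Fin m) (Fin m) k) ij.1 ij.2) :
        MvPolynomial ((ι ⊕ ι) ⊕ ι) k)) < 1}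
  let S₃ : Set ((ι ⊕ ι) ⊕ ι → U) :=
    ⋂ ij : ι, {w | MvPolynomial.aeval w
        (MvPolynomial.X (Sum.inl (Sum.inl ij)) : MvPolynomial ((ι ⊕ ι) ⊕ ι) k) =
      MvPolynomial.aeval w (∑ l, MvPolynomial.X (Sum.inr (ij.1, l)) *
        MvPolynomial.X (Sum.inl (Sum.inr (l, ij.2))) : MvPolynomial ((ι ⊕ ι) ⊕ ι) k)}
  have h₁ : (∅ : Set U).Definable (valLang k) S₁ :=
    Set.definable_iInter_of_finite fun f => definable_aeval_eq _ _
  have h₂ : (∅ : Set U).Definable (valLang k) S₂ :=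
    Set.definable_iInter_of_finite fun ij => definable_valuation_lt_one _
  have h₃ : (∅ : Set U).Definable (valLang k) S₃ :=
    Set.definable_iInter_of_finite fun ij => definable_aeval_eq _ _
  have h := ((h₁.inter h₂).inter h₃).exists_of_finite
  convert h using 1
  have hone : ∀ i j, algebraMap k U ((1 : Matrix (Fin m) (Fin m) k) i j) =
      (1 : Matrix (Fin m) (Fin m) U) i j := by
    intro i j
    simp only [Matrix.one_apply]
    split_ifs <;> simp
  have e₁ : ∀ (v : ι ⊕ ι → U) (x : ι → U), Sum.elim v x ∈ S₁ ↔
      ∀ f ∈ s, MvPolynomial.aeval x f = 0 := by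
    intro v x
    simp [S₁, MvPolynomial.aeval_rename]
  have e₂ : ∀ (v : ι ⊕ ι → U) (x : ι → U), Sum.elim v x ∈ S₂ ↔
      ∀ i j, (LocModel.O k (U := U)).valuation
        (x (i, j) - (1 : Matrix (Fin m) (Fin m) U) i j) < 1 := by
    intro v x
    simp [S₂, ι, hone]
  have e₃ : ∀ (v : ι ⊕ ι → U) (x : ι → U), Sum.elim v x ∈ S₃ ↔
      ∀ i j, v (Sum.inl (i, j)) = ∑ l, x (i, l) * v (Sum.inr (l, j)) := by
    intro v x
    simp [S₃, ι]
  ext v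
  constructor
  · rintro ⟨e, he, hv⟩
    obtain ⟨hep, hec⟩ := mem_mu_iff.1 he
    exact ⟨coords e, ⟨(e₁ _ _).2 ((hs e).1 hep), (e₂ _ _).2 (mem_congruenceSubgroup_iff.1 hec)⟩,
      (e₃ _ _).2 hv⟩
  · rintro ⟨x, ⟨hx₁, hx₂⟩, hx₃⟩
    rw [e₁] at hx₁
    rw [e₂] at hx₂
    rw [e₃] at hx₃
    obtain ⟨e, he, hex⟩ := exists_mem_congruenceSubgroup
      (M := Matrix.of fun i j => x (i, j)) hx₂
    have hcx : coords e = x := by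
      funext ij
      rw [coords, hex]
      rfl
    refine ⟨e, mem_mu_iff.2 ⟨(hs e).2 (hcx ▸ hx₁), he⟩, fun i j => ?_⟩
    rw [hx₃, hex]
    rfl

theorem coords_mem_muRel_iff {x y : GL (Fin m) U} :
    Sum.elim (coords x) (coords y) ∈ muRel G U ↔ ∃ e ∈ mu G U, x = e * y := by
  refine exists_congr fun e => and_congr_right fun _ => ⟨fun h => ?_, ?_⟩
  · ext i j
    rw [Units.val_mul, Matrix.mul_apply]
    exact h i j
  · rintro rfl i j
    exact Matrix.mul_apply

theorem exists_coords_eq_of_mem_muRel {x : Fin m × Fin m → U} {y : GL (Fin m) U}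
    (h : Sum.elim x (coords y) ∈ muRel G U) : ∃ g : GL (Fin m) U, coords g = x := by
  obtain ⟨e, -, he⟩ := h
  refine ⟨e * y, funext fun ij => ?_⟩
  rw [coords, Units.val_mul, Matrix.mul_apply]
  exact (he ij.1 ij.2).symm

variable {p : TypesOver k U (Fin m × Fin m)}

theorem Realizes.exists_coords_eq (hp : IsTypeOn G p) {x : Fin m × Fin m → U}
    (hx : Realizes p x) : ∃ g ∈ points G U, coords g = x := by
  obtain ⟨ψ, hψ, hG⟩ := hp
  exact hG x (hx ψ hψ)

theorem exists_realizes_coords [Infinite k] (hU : IsMonster k U) (hp : IsTypeOn G p) :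
    ∃ a ∈ points G U, Realizes p (coords a) := by
  obtain ⟨x, hx⟩ := exists_realizes hU p
  obtain ⟨a, ha, rfl⟩ := hx.exists_coords_eq hp
  exact ⟨a, ha, hx⟩

/-- By saturation, `mu · p` is the set of the products of elements of `mu` and realizations
of `p`. -/
theorem mem_tube_iff [Infinite k] (hU : IsMonster k U) (hp : IsTypeOn G p) {x : GL (Fin m) U} :
    x ∈ tube G p ↔ ∃ e ∈ mu G U, ∃ b ∈ points G U, Realizes p (coords b) ∧ x = e * b := by
  constructor
  · intro hx
    obtain ⟨y, hy, hxy⟩ := exists_realizes_of_forall (p := p) hU (definable_muRel G U)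
      (coords x) fun ψ hψ => by
        obtain ⟨φ, hφ, hG⟩ := hp
        obtain ⟨e, he, y, -, hψy, hxy⟩ := hx (ψ ⊓ φ) (contains_inf hψ hφ)
          fun z hz => hG z (Formula.realize_inf.1 hz).2
        exact ⟨coords y, (Formula.realize_inf.1 hψy).1, coords_mem_muRel_iff.2 ⟨e, he, hxy⟩⟩
    obtain ⟨b, hb, rfl⟩ := hy.exists_coords_eq hp
    obtain ⟨e, he, hxe⟩ := coords_mem_muRel_iff.1 hxy
    exact ⟨e, he, b, hb, hy, hxe⟩
  · rintro ⟨e, he, b, hb, hbp, rfl⟩ ψ hψ -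
    exact ⟨e, he, b, hb, hbp ψ hψ, rfl⟩

theorem muMul_subset_points (ψ : (valLang k).Formula (Fin m × Fin m)) :
    muMul G ψ ⊆ points G U := by
  rintro _ ⟨e, he, y, hy, -, rfl⟩
  exact mul_mem_points G (mem_mu_iff.1 he).1 hy

theorem definable_muMul {ψ : (valLang k).Formula (Fin m × Fin m)} (hψ : IsGFormula G U ψ) :
    (∅ : Set U).Definable (valLang k) (coords '' muMul (U := U) G ψ) := by
  convert ((definable_muRel G U).inter
    ((definable_realize ψ).preimage_comp Sum.inr)).exists_of_finite using 1
  ext x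
  constructor
  · rintro ⟨_, ⟨e, he, y, hy, hψy, rfl⟩, rfl⟩
    exact ⟨coords y, coords_mem_muRel_iff.2 ⟨e, he, rfl⟩, hψy⟩
  · rintro ⟨z, hz, hψz⟩
    obtain ⟨y, hy, rfl⟩ := hψ z hψz
    obtain ⟨g, rfl⟩ := exists_coords_eq_of_mem_muRel hz
    obtain ⟨e, he, rfl⟩ := coords_mem_muRel_iff.1 hz
    exact ⟨_, ⟨e, he, y, hy, hψz, rfl⟩, rfl⟩

/-- If `h ∈ G(k)` maps one realization of `p` into `mu · p` then it maps all realizations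
into `mu · p`. -/
theorem mul_mem_tube_of_realizes {h : GL (Fin m) k} {a b : GL (Fin m) U} (ha : Realizes p (coords a))
    (hb : Realizes p (coords b)) (hab : incl k m U h * a ∈ tube G p) :
    incl k m U h * b ∈ tube G p := by
  intro ψ hψ hG
  -- As `h` has entries in `k`, the condition `h * y ∈ μ · ψ` is a formula over `k`, which all
  -- realizations of `p` satisfy or none.
  have hdef : (∅ : Set U).Definable (valLang k)
      {y : Fin m × Fin m → U |
        (fun ij : Fin m × Fin m => ∑ l, (incl k m U h).val ij.1 l * y (l, ij.2)) ∈
          coords '' muMul (U := U) G ψ} := by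
    refine Set.Definable.preimage_map (F := fun (y : Fin m × Fin m → U) (ij : Fin m × Fin m) =>
      ∑ l, (incl k m U h).val ij.1 l * y (l, ij.2)) (fun ij => ?_) (definable_muMul hG)
    have := definableFun_aeval (U := U) (∑ l, MvPolynomial.C (h.val ij.1 l) *
      MvPolynomial.X (l, ij.2) : MvPolynomial (Fin m × Fin m) k)
    simpa using this
  obtain ⟨χ, hχ⟩ := Set.empty_definable_iff.1 hdef
  have hrw : ∀ c : GL (Fin m) U, (χ.Realize (coords c) ↔ incl k m U h * c ∈ muMul G ψ) := by
    intro c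
    have h1 : (fun ij : Fin m × Fin m => ∑ l, (incl k m U h).val ij.1 l * coords c (l, ij.2)) =
        coords (incl k m U h * c) := by
      funext ij
      exact Matrix.mul_apply.symm
    have h2 : χ.Realize (coords c) ↔ coords c ∈ {y : Fin m × Fin m → U |
        (fun ij : Fin m × Fin m => ∑ l, (incl k m U h).val ij.1 l * y (l, ij.2)) ∈
          coords '' muMul (U := U) G ψ} := by
      rw [hχ]
      rfl
    rw [h2, Set.mem_ofPred, h1, coords_injective.mem_set_image]
  rw [← hrw, ← hb.contains_iff, ha.contains_iff, hrw]
  exact hab ψ hψ hG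

theorem mul_mem_tube_of_mem_muSubgroup [Infinite k] (hU : IsMonster k U) (hp : IsTypeOn G p)
    {e x : GL (Fin m) U} (he : e ∈ muSubgroup U G) (hx : x ∈ tube G p) : e * x ∈ tube G p := by
  obtain ⟨e', he', b, hb, hbp, rfl⟩ := (mem_tube_iff hU hp).1 hx
  exact (mem_tube_iff hU hp).2 ⟨e * e',
    mem_mu_iff_mem_muSubgroup.2 (mul_mem he (mem_mu_iff_mem_muSubgroup.1 he')), b, hb, hbp,
    (mul_assoc _ _ _).symm⟩

/-- If `h · (mu · p)` meets `mu · p` then it is contained in `mu · p`. -/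
theorem mul_mem_tube [Infinite k] (hU : IsMonster k U) (hp : IsTypeOn G p)
    {h : GL (Fin m) k} (hh : h ∈ G) {x y : GL (Fin m) U} (hx : x ∈ tube G p)
    (hxy : incl k m U h * x ∈ tube G p) (hy : y ∈ tube G p) : incl k m U h * y ∈ tube G p := by
  obtain ⟨e, he, a, -, hap, rfl⟩ := (mem_tube_iff hU hp).1 hx
  obtain ⟨e', he', b, -, hbp, rfl⟩ := (mem_tube_iff hU hp).1 hy
  -- Moving `h` past `e` replaces `e` by a conjugate that is still in `μ`, which reduces the claim
  -- to realizations.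
  have hconj : ∀ (e c : GL (Fin m) U),
      incl k m U h * (e * c) = incl k m U h * e * (incl k m U h)⁻¹ * (incl k m U h * c) := by
    intro e c
    group
  have ha : incl k m U h * a ∈ tube G p := by
    have := mul_mem_tube_of_mem_muSubgroup hU hp
      (inv_mem (conj_mem_muSubgroup hh (mem_mu_iff_mem_muSubgroup.1 he))) hxy
    rwa [hconj, inv_mul_cancel_left] at this
  rw [hconj]
  exact mul_mem_tube_of_mem_muSubgroup hU hp
    (conj_mem_muSubgroup hh (mem_mu_iff_mem_muSubgroup.1 he'))
    (mul_mem_tube_of_realizes hap hbp ha)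

theorem realizes_mem_tube {a : GL (Fin m) U} (ha : a ∈ points G U) (hap : Realizes p (coords a)) :
    a ∈ tube G p := fun ψ hψ _ =>
  ⟨1, mem_mu_iff_mem_muSubgroup.2 (one_mem _), a, ha, hap ψ hψ, (one_mul a).symm⟩

theorem mem_GbarPoints_iff {h : GL (Fin m) k} :
    h ∈ GbarPoints G p ↔ h ∈ G ∧ ∃ y ∈ tube G p, incl k m U h * y ∈ tube G p := by
  refine and_congr_right fun hh => ⟨?_, ?_⟩
  · rintro ⟨⟨x, hx, y, hy, hxy⟩, -⟩
    refine ⟨y, hy, ?_⟩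
    rwa [hxy, inv_mul_cancel_right]
  · rintro ⟨y, hy, hx⟩
    exact ⟨⟨_, hx, y, hy, (mul_inv_cancel_right _ _).symm⟩, incl_mem_points G hh,
      fun i j => LocModel.algebraMap_mem _⟩

theorem muStab_eq_GbarPoints [Infinite k] (hU : IsMonster k U) (hp : IsTypeOn G p) :
    muStab G p = GbarPoints G p := by
  ext h
  rw [mem_GbarPoints_iff]
  refine and_congr_right fun hh => ⟨fun hstab => ?_, ?_⟩
  · obtain ⟨a, ha, hap⟩ := exists_realizes_coords hU hp
    have hat := realizes_mem_tube ha hap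
    -- The stabilizer condition is tested on the definable sets `X = μ · ψ`, whose intersection is
    -- `μ · p`.
    refine ⟨(incl k m U h)⁻¹ * a, fun ψ hψ hG => ?_, by rwa [mul_inv_cancel_left]⟩
    have hsub : tube G p ⊆ muMul G ψ := fun x hx => hx ψ hψ hG
    obtain ⟨x, hx, hxa⟩ := (hstab _ (muMul_subset_points ψ)
      (definable_loc (definable_muMul hG))).2 hsub hat
    rw [← hxa]
    simpa using hx
  · rintro ⟨y, hy, hx⟩ X - -
    constructor
    · intro hX z hz
      obtain ⟨w, hw, hwz⟩ := hX (mul_mem_tube hU hp hh hy hx hz)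
      rwa [← mul_left_cancel hwz]
    · intro hX z hz
      refine ⟨(incl k m U h)⁻¹ * z, hX ?_, mul_inv_cancel_left _ _⟩
      rw [← map_inv]
      refine mul_mem_tube hU hp (inv_mem hh) hx ?_ hz
      rwa [map_inv, inv_mul_cancel_left]

end Tube

/-! ### Residues of translates of a locus -/

section Specialization

variable {k : Type u} [Field k] {m : ℕ} {U : Type v} [Field U] [Algebra k U]

/-- A polynomial expression in elements that are integral over a `k`-subalgebra is integral. -/
theorem isIntegral_aeval {B σ : Type*} [CommRing B] [Algebra k B] (C : Subalgebra k B) {x : σ → B}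
    (hx : ∀ i, IsIntegral C (x i)) (f : MvPolynomial σ k) :
    IsIntegral C (MvPolynomial.aeval x f) := by
  induction f using MvPolynomial.induction_on with
  | C c =>
    rw [MvPolynomial.aeval_C]
    exact isIntegral_algebraMap (R := C) (x := algebraMap k C c)
  | add f g hf hg => rw [map_add]; exact hf.add hg
  | mul_X f i hf => rw [map_mul, MvPolynomial.aeval_X]; exact hf.mul (hx i)

variable (k) in
/-- The coordinate ring of the locus of `a` over `k` in `GL_m`. -/
abbrev locusRing (a : GL (Fin m) U) : Type u :=
  Localization.Away (Ideal.Quotient.mk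
    (RingHom.ker (MvPolynomial.aeval (coords a) : MvPolynomial (Fin m × Fin m) k →ₐ[k] U))
    (Matrix.mvPolynomialX (Fin m) (Fin m) k).det)

variable (k) in
/-- The restriction of polynomials to the locus of `a`. -/
noncomputable def toLocusRing (a : GL (Fin m) U) :
    MvPolynomial (Fin m × Fin m) k →ₐ[k] locusRing k a :=
  (IsScalarTower.toAlgHom k (MvPolynomial (Fin m × Fin m) k ⧸
    RingHom.ker (MvPolynomial.aeval (coords a) : MvPolynomial (Fin m × Fin m) k →ₐ[k] U)) _).comp
    (Ideal.Quotient.mkₐ k _)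

theorem isUnit_toLocusRing_det (a : GL (Fin m) U) :
    IsUnit (toLocusRing k a (Matrix.mvPolynomialX (Fin m) (Fin m) k).det) :=
  IsLocalization.Away.algebraMap_isUnit (Ideal.Quotient.mk
    (RingHom.ker (MvPolynomial.aeval (coords a) : MvPolynomial (Fin m × Fin m) k →ₐ[k] U))
    (Matrix.mvPolynomialX (Fin m) (Fin m) k).det)

theorem exists_mul_eq_toLocusRing (a : GL (Fin m) U) (x : locusRing k a) :
    ∃ f w, IsUnit w ∧ x * w = toLocusRing k a f := by
  obtain ⟨⟨f, w⟩, hx⟩ := IsLocalization.surj (Submonoid.powers (Ideal.Quotient.mk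
    (RingHom.ker (MvPolynomial.aeval (coords a) : MvPolynomial (Fin m × Fin m) k →ₐ[k] U))
    (Matrix.mvPolynomialX (Fin m) (Fin m) k).det)) x
  obtain ⟨f, rfl⟩ := Ideal.Quotient.mk_surjective f
  exact ⟨f, _, IsLocalization.map_units _ w, hx⟩

theorem aeval_coords_det (b : GL (Fin m) U) :
    MvPolynomial.aeval (coords b) (Matrix.mvPolynomialX (Fin m) (Fin m) k).det = b.val.det := by
  rw [← AlgHom.coe_toRingHom, RingHom.map_det]
  exact congrArg _ (Matrix.mvPolynomialX_mapMatrix_aeval k b.val)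

/-- Specializations of `a` over `k` correspond to homomorphisms from the coordinate ring of its
locus. -/
theorem exists_algHom_locusRing {a b : GL (Fin m) U}
    (hab : ∀ f : MvPolynomial (Fin m × Fin m) k, MvPolynomial.aeval (coords a) f = 0 →
      MvPolynomial.aeval (coords b) f = 0) :
    ∃ φ : locusRing k a →ₐ[k] U, ∀ f, φ (toLocusRing k a f) = MvPolynomial.aeval (coords b) f := by
  let ψ := Ideal.Quotient.liftₐ
    (RingHom.ker (MvPolynomial.aeval (coords a) : MvPolynomial (Fin m × Fin m) k →ₐ[k] U))
    (MvPolynomial.aeval (coords b) : _ →ₐ[k] U) hab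
  have hψ : IsUnit (ψ (Ideal.Quotient.mk _ (Matrix.mvPolynomialX (Fin m) (Fin m) k).det)) := by
    change IsUnit (MvPolynomial.aeval (coords b) _)
    rw [aeval_coords_det]
    exact (Matrix.isUnit_iff_isUnit_det _).1 b.isUnit
  refine ⟨IsLocalization.liftAlgHom (M := Submonoid.powers (Ideal.Quotient.mk _
    (Matrix.mvPolynomialX (Fin m) (Fin m) k).det)) (f := ψ) ?_, fun f => ?_⟩
  · rintro ⟨_, n, rfl⟩
    rw [map_pow]
    exact hψ.pow n
  · exact IsLocalization.lift_eq _ _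

theorem kerZeros_toLocusRing (a : GL (Fin m) U) :
    kerZeros (toLocusRing k a) =
      {g | ∀ f : MvPolynomial (Fin m × Fin m) k,
        MvPolynomial.aeval (coords a) f = 0 → MvPolynomial.eval (coords g) f = 0} := by
  obtain ⟨φ, hφ⟩ := exists_algHom_locusRing (k := k) (a := a) (b := a) fun _ h => h
  have : ∀ f, toLocusRing k a f = 0 ↔ MvPolynomial.aeval (coords a) f = 0 := by
    refine fun f => ⟨fun h => by rw [← hφ, h, map_zero], fun h => ?_⟩
    have : Ideal.Quotient.mkₐ k (RingHom.ker (MvPolynomial.aeval (coords a) :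
      MvPolynomial (Fin m × Fin m) k →ₐ[k] U)) f = 0 := Ideal.Quotient.eq_zero_iff_mem.2 h
    rw [toLocusRing, AlgHom.comp_apply, this, map_zero]
  simp only [kerZeros, this]

/-- Translates by `a⁻¹` of the specializations of `a` satisfy a nontrivial polynomial relation
between any `r` polynomials if `r` exceeds the dimension of the locus of `a`. -/
theorem exists_relation_of_lt {a c : GL (Fin m) U} {d r : ℕ}
    (g : MvPolynomial (Fin d) k →ₐ[k] locusRing k a) (hg : g.IsIntegral) (hdr : d < r)
    (f : Fin r → MvPolynomial (Fin m × Fin m) k) :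
    ∃ F : MvPolynomial (Fin r) U, F ≠ 0 ∧ ∀ b : GL (Fin m) U,
      (∀ f : MvPolynomial (Fin m × Fin m) k, MvPolynomial.aeval (coords a) f = 0 →
        MvPolynomial.aeval (coords b) f = 0) →
      MvPolynomial.eval (fun i => MvPolynomial.aeval (coords (b * c)) (f i)) F = 0 := by
  -- `B` is the ring of `U`-valued functions on the `U`-points of the locus; `x` is the matrix `b *
  -- c` as a function of the point `b`, and `t` consists of the values of the `f i` there.
  let B := (locusRing k a →ₐ[k] U) → U
  let ev : locusRing k a →ₐ[k] B := AlgHom.pi fun φ => φ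
  let y : Fin d → B := fun i => ev (g (MvPolynomial.X i))
  let C : Subalgebra U B := Algebra.adjoin U (Set.range y)
  let x : Fin m × Fin m → B := fun ij =>
    ∑ l, ev (toLocusRing k a (MvPolynomial.X (ij.1, l))) * algebraMap U B (c.val l ij.2)
  let t : Fin r → B := fun i => MvPolynomial.aeval x (f i)
  have hC : ∀ H : MvPolynomial (Fin d) k, ev (g H) ∈ C := by
    intro H
    have : (ev.comp g) = MvPolynomial.aeval y := by ext i; simp [y]
    have h2 : ev (g H) = MvPolynomial.aeval y H := DFunLike.congr_fun this H
    rw [h2]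
    have h3 : (MvPolynomial.aeval y : _ →ₐ[k] B).range ≤ C.restrictScalars k := by
      rw [← Algebra.adjoin_range_eq_range_aeval]
      exact Algebra.adjoin_le Algebra.subset_adjoin
    exact h3 ⟨H, rfl⟩
  have hev : ∀ z, IsIntegral C (ev z) := by
    intro z
    obtain ⟨P, hP, hPz⟩ := hg z
    let σ : MvPolynomial (Fin d) k →+* C := (ev.comp g).toRingHom.codRestrict C hC
    refine ⟨P.map σ, hP.map _, ?_⟩
    rw [Polynomial.eval₂_map]
    have h := Polynomial.hom_eval₂ P g.toRingHom ev.toRingHom z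
    have h0 : Polynomial.eval₂ g.toRingHom z P = 0 := hPz
    rw [h0, map_zero] at h
    exact h.symm
  have hx : ∀ ij, IsIntegral C (x ij) := fun ij => IsIntegral.sum _ fun l _ =>
    (hev _).mul (isIntegral_algebraMap (R := C) (x := algebraMap U C (c.val l ij.2)))
  have ht : ∀ i, IsIntegral C (t i) := fun i =>
    isIntegral_aeval (C.restrictScalars k) hx (f i)
  -- The `t i` are integral over the `U`-algebra generated by the `d` normalizing functions.
  have hdep : ¬ AlgebraicIndependent U t := fun h =>
    hdr.not_ge (card_le_of_isIntegral_adjoin y t h ht)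
  rw [AlgebraicIndependent, injective_iff_map_eq_zero] at hdep
  push Not at hdep
  obtain ⟨F, hF, hF0⟩ := hdep
  refine ⟨F, hF0, fun b hb => ?_⟩
  obtain ⟨φ, hφ⟩ := exists_algHom_locusRing hb
  have hxφ : ∀ ij, x ij φ = coords (b * c) ij := by
    intro ij
    have h1 : x ij φ = ∑ l, φ (toLocusRing k a (MvPolynomial.X (ij.1, l))) * c.val l ij.2 := by
      exact Finset.sum_apply φ Finset.univ _
    rw [h1, coords, Units.val_mul, Matrix.mul_apply]
    refine Finset.sum_congr rfl fun l _ => ?_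
    rw [hφ, MvPolynomial.aeval_X]
    rfl
  have htφ : ∀ i, t i φ = MvPolynomial.aeval (coords (b * c)) (f i) := by
    intro i
    have h1 := MvPolynomial.comp_aeval_apply x
      (Pi.evalAlgHom k (fun _ : locusRing k a →ₐ[k] U => U) φ) (f i)
    have h2 : (fun ij => Pi.evalAlgHom k (fun _ : locusRing k a →ₐ[k] U => U) φ (x ij)) =
        coords (b * c) := funext hxφ
    rw [h2] at h1
    exact h1
  have h1 := MvPolynomial.comp_aeval_apply t
    (Pi.evalAlgHom U (fun _ : locusRing k a →ₐ[k] U => U) φ) F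
  have h2 : (fun i => Pi.evalAlgHom U (fun _ : locusRing k a →ₐ[k] U => U) φ (t i)) =
      fun i => MvPolynomial.aeval (coords (b * c)) (f i) := funext htφ
  rw [h2, hF, map_zero] at h1
  exact h1.symm

variable [LocModel k U]

/-- If the integral matrix `e h` with residue `h` satisfies a relation between polynomials for all
`h` in a set of rational points, then a relation over `k` holds on that set. -/
theorem exists_relation_of_residue {r : ℕ} {F : MvPolynomial (Fin r) U} (hF : F ≠ 0)
    (f : Fin r → MvPolynomial (Fin m × Fin m) k) {S : Set (GL (Fin m) k)}
    (hS : ∀ h ∈ S, ∃ e ∈ congruenceSubgroup (LocModel.O k (U := U)) m,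
      MvPolynomial.eval (fun i => MvPolynomial.aeval (coords (e * incl k m U h)) (f i)) F = 0) :
    ∃ H : MvPolynomial (Fin r) k, H ≠ 0 ∧ ∀ h ∈ S,
      MvPolynomial.eval (fun i => MvPolynomial.eval (coords h) (f i)) H = 0 := by
  let O := LocModel.O k (U := U)
  let κ := IsLocalRing.ResidueField O
  let π : O →+* κ := IsLocalRing.residue O
  let := (toO U k).toAlgebra
  let : Algebra k κ := (π.comp (toO U k)).toAlgebra
  obtain ⟨F', hF', c, hc⟩ := exists_integral_polynomial O hF
  -- The reduction of `F'` is a relation over the residue field that holds at points rational over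
  -- `k`, so it descends to `k`.
  obtain ⟨H, hH0, hH⟩ := exists_ne_zero_of_eval_eq_zero hF'
    ((fun h i => MvPolynomial.eval (coords h) (f i)) '' S) (by
      rintro _ ⟨h, hh, rfl⟩
      obtain ⟨e, ⟨E, hE, rfl⟩, he⟩ := hS h hh
      -- `M` is the integral form of `e h`: it maps to `e h` over `U`, and to `h` over the residue
      -- field because `E` reduces to `1`.
      let M := E * Matrix.GeneralLinearGroup.map (n := Fin m) (toO U k) h
      let x : Fin m × Fin m → O := fun ij => M.val ij.1 ij.2
      let τ : Fin r → O := fun i => MvPolynomial.eval₂ (toO U k) x (f i)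
      have hxU : (fun ij => algebraMap O U (x ij)) =
          coords (Matrix.GeneralLinearGroup.map (algebraMap O U) E * incl k m U h) := by
        have : Matrix.GeneralLinearGroup.map (algebraMap O U) M =
            Matrix.GeneralLinearGroup.map (algebraMap O U) E * incl k m U h := map_mul _ _ _
        rw [← this]
        rfl
      have hxπ : (fun ij => π (x ij)) = fun ij => π (toO U k (coords h ij)) := by
        have : Matrix.GeneralLinearGroup.map π M = Matrix.GeneralLinearGroup.map π
            (Matrix.GeneralLinearGroup.map (toO U k) h) := by
          rw [map_mul, MonoidHom.mem_ker.1 hE, one_mul]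
        funext ij
        exact congrArg (fun g => g.val ij.1 ij.2) this
      have hτU : ∀ i, algebraMap O U (τ i) = MvPolynomial.aeval
          (coords (Matrix.GeneralLinearGroup.map (algebraMap O U) E * incl k m U h)) (f i) := by
        intro i
        rw [MvPolynomial.eval₂_comp_left, MvPolynomial.aeval_def, ← hxU]
        rfl
      have hτπ : ∀ i, π (τ i) = algebraMap k κ (MvPolynomial.eval (coords h) (f i)) := by
        intro i
        have h1 := MvPolynomial.eval₂_comp_left π (toO U k) x (f i)
        have h2 : (π ∘ x) = fun ij => π (toO U k (coords h ij)) := hxπ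
        rw [h2] at h1
        have h3 := MvPolynomial.eval₂_comp_left (π.comp (toO U k)) (RingHom.id k) (coords h) (f i)
        exact h1.trans h3.symm
      have h0 : MvPolynomial.eval τ F' = 0 := by
        refine (FaithfulSMul.algebraMap_injective O U) ?_
        have h1 := MvPolynomial.eval₂_comp_left (algebraMap O U) (RingHom.id O) τ F'
        have h2 : (algebraMap O U ∘ τ) = fun i => MvPolynomial.aeval
          (coords (Matrix.GeneralLinearGroup.map (algebraMap O U) E * incl k m U h)) (f i) :=
          funext hτU
        rw [h2, RingHom.comp_id, ← MvPolynomial.eval_map (algebraMap O U), hc, map_mul, he,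
          mul_zero] at h1
        rw [map_zero]
        exact h1
      have h1 := MvPolynomial.eval₂_comp_left π (RingHom.id O) τ F'
      have h2 : (π ∘ τ) = fun i => algebraMap k κ (MvPolynomial.eval (coords h) (f i)) :=
        funext hτπ
      rw [h2, RingHom.comp_id, ← MvPolynomial.eval_map π] at h1
      refine h1.symm.trans ?_
      exact (congrArg π h0).trans (map_zero π))
  exact ⟨H, hH0, fun h hh => hH _ ⟨h, hh, rfl⟩⟩

/-- A set of rational points that are residues of translates `b a⁻¹` of specializations `b` of `a`
has at most the dimension of the locus of `a`. -/
theorem zdim_le_zdim_locus [IsAlgClosed k] (a : GL (Fin m) U) {S : Set (GL (Fin m) k)}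
    (hS : ∀ h ∈ S, ∃ b : GL (Fin m) U,
      (∀ f : MvPolynomial (Fin m × Fin m) k, MvPolynomial.aeval (coords a) f = 0 →
        MvPolynomial.aeval (coords b) f = 0) ∧
      ∃ e ∈ congruenceSubgroup (LocModel.O k (U := U)) m, b * a⁻¹ = e * incl k m U h) :
    zdim S ≤
      zdim {g | ∀ f : MvPolynomial (Fin m × Fin m) k,
        MvPolynomial.aeval (coords a) f = 0 → MvPolynomial.eval (coords g) f = 0} := by
  have hft : Algebra.FiniteType k (locusRing k a) :=
    Algebra.FiniteType.trans (S := MvPolynomial (Fin m × Fin m) k ⧸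
      RingHom.ker (MvPolynomial.aeval (coords a) : MvPolynomial (Fin m × Fin m) k →ₐ[k] U))
      inferInstance (IsLocalization.finiteType_of_monoid_fg (Submonoid.powers (Ideal.Quotient.mk _
        (Matrix.mvPolynomialX (Fin m) (Fin m) k).det)) _)
  have hnt : Nontrivial (locusRing k a) := by
    obtain ⟨φ, -⟩ := exists_algHom_locusRing (k := k) (a := a) (b := a) fun _ h => h
    exact φ.toRingHom.domain_nontrivial
  obtain ⟨d, g, -, hint, hdim⟩ := exists_noether_normalization k (locusRing k a)
  -- Only the lower bound for the dimension of the locus is needed: it is at least the number `d` of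
  -- normalizing variables.
  have hle := ringKrullDim_le_zdim (isUnit_toLocusRing_det (k := k) a) (exists_mul_eq_toLocusRing a)
  rw [kerZeros_toLocusRing, hdim] at hle
  refine (zdim_le_of_forall fun r f hind => ?_).trans hle
  by_contra! hdr
  obtain ⟨F, hF0, hF⟩ := exists_relation_of_lt (c := a⁻¹) g hint hdr f
  obtain ⟨H, hH0, hH⟩ := exists_relation_of_residue hF0 f (S := S) fun h hh => by
    obtain ⟨b, hb, e, he, hbe⟩ := hS h hh
    refine ⟨e, he, ?_⟩
    rw [← hbe]
    exact hF b hb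
  exact hH0 (hind H hH)

end Specialization

/-! ### The dimension inequality and the minimal formula -/

section MainTheorem

open FirstOrder.Language

variable {k : Type u} [Field k] {m : ℕ} {G : Subgroup (GL (Fin m) k)}
  {U : Type v} [Field U] [Algebra k U] [LocModel k U] {p : TypesOver k U (Fin m × Fin m)}

/-- An equation over `k` is itself a formula, so by completeness `p` decides it. Thus the closure of
`p` is the locus of any realization. -/
theorem Realizes.implies_iff {ι : Type} {p : TypesOver k U ι} {x : ι → U} (hx : Realizes p x)
    (f : MvPolynomial ι k) :
    Implies p {y : ι → U | MvPolynomial.aeval y f = 0} ↔ MvPolynomial.aeval x f = 0 := by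
  constructor
  · rintro ⟨ψ, hψ, h⟩
    exact h x (hx ψ hψ)
  · intro h
    obtain ⟨ψ, hψ⟩ := Set.empty_definable_iff.1 (definable_aeval_eq (U := U) f 0)
    have hψ' : ∀ y : ι → U, ψ.Realize y ↔ MvPolynomial.aeval y f = 0 := by
      intro y
      have : y ∈ {v : ι → U | MvPolynomial.aeval v f =
          MvPolynomial.aeval v (0 : MvPolynomial ι k)} ↔ ψ.Realize y := by
        rw [hψ]; rfl
      rw [← this, Set.mem_ofPred, map_zero]
    exact ⟨ψ, (hx.contains_iff ψ).2 ((hψ' x).2 h), fun y hy => (hψ' y).1 hy⟩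

theorem zdim_GbarPoints_le [IsAlgClosed k] (hU : IsMonster k U) (hp : IsTypeOn G p) :
    zdim (GbarPoints G p) ≤ typeDim p := by
  obtain ⟨a, ha, hap⟩ := exists_realizes_coords hU hp
  have hcl : typeClosure p =
      {g | ∀ f : MvPolynomial (Fin m × Fin m) k,
        MvPolynomial.aeval (coords a) f = 0 → MvPolynomial.eval (coords g) f = 0} := by
    simp only [typeClosure, hap.implies_iff]
  rw [typeDim, hcl]
  refine zdim_le_zdim_locus a fun h hh => ?_
  obtain ⟨hhG, y, hy, hxy⟩ := mem_GbarPoints_iff.1 hh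
  obtain ⟨e, he, b, -, hbp, hhb⟩ := (mem_tube_iff hU hp).1
    (mul_mem_tube hU hp hhG hy hxy (realizes_mem_tube ha hap))
  -- From `h * a = e * b` one gets `b * a⁻¹ = e⁻¹ * h`, whose residue is `h`.
  refine ⟨b, fun f hf => (hbp.implies_iff f).1 ((hap.implies_iff f).2 hf), e⁻¹,
    inv_mem (mem_mu_iff.1 he).2, ?_⟩
  rw [eq_inv_mul_iff_mul_eq, ← mul_assoc, ← hhb, mul_inv_cancel_right]

theorem typeClosure_subset_formulaClosure {ψ : (valLang k).Formula (Fin m × Fin m)}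
    (hψ : Contains p ψ) : typeClosure p ⊆ formulaClosure U ψ :=
  fun _ hg f hf => hg f ⟨ψ, hψ, hf⟩

theorem exists_formulaClosure_eq [Infinite k] (hU : IsMonster k U) (hp : IsTypeOn G p) :
    ∃ ψ, Contains p ψ ∧ IsGFormula G U ψ ∧ formulaClosure U ψ = typeClosure p := by
  obtain ⟨a, -, hap⟩ := exists_realizes_coords hU hp
  obtain ⟨φ, hφ, hφG⟩ := hp
  let I := RingHom.ker (MvPolynomial.aeval (coords a) : MvPolynomial (Fin m × Fin m) k →ₐ[k] U)
  obtain ⟨s, hs⟩ : I.FG := IsNoetherian.noetherian I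
  -- The minimizing formula is a `G`-formula of `p` together with the generators of the ideal of the
  -- locus.
  have hdef : (∅ : Set U).Definable (valLang k) ({x : Fin m × Fin m → U | φ.Realize x} ∩
      ⋂ f : s, {x | MvPolynomial.aeval x f.1 =
        MvPolynomial.aeval x (0 : MvPolynomial (Fin m × Fin m) k)}) :=
    (definable_realize φ).inter (Set.definable_iInter_of_finite fun f => definable_aeval_eq _ _)
  obtain ⟨ψ, hψ⟩ := Set.empty_definable_iff.1 hdef
  have hψ' : ∀ x : Fin m × Fin m → U, ψ.Realize x ↔
      φ.Realize x ∧ ∀ f ∈ s, MvPolynomial.aeval x f = 0 := by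
    intro x
    have : ψ.Realize x ↔ x ∈ {x : Fin m × Fin m → U | φ.Realize x} ∩
      ⋂ f : s, {x | MvPolynomial.aeval x f.1 =
        MvPolynomial.aeval x (0 : MvPolynomial (Fin m × Fin m) k)} := by
      rw [hψ]; rfl
    rw [this]
    simp
  have hcon : Contains p ψ := (hap.contains_iff ψ).2 ((hψ' _).2 ⟨hap φ hφ, fun f hf => by
    have : f ∈ I := hs ▸ Submodule.subset_span hf
    exact this⟩)
  refine ⟨ψ, hcon, fun x hx => hφG x ((hψ' x).1 hx).1,
    (typeClosure_subset_formulaClosure hcon).antisymm' fun g hg f hf => hg f fun x hx => ?_⟩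
  have hle : I ≤ RingHom.ker (MvPolynomial.aeval x : _ →ₐ[k] U) := by
    rw [← hs]
    exact Ideal.span_le.2 fun f hf => ((hψ' x).1 hx).2 f hf
  exact hle ((hap.implies_iff f).1 hf)

end MainTheorem

end MuStab

theorem mainTheorem7 {k : Type u} [Field k] [IsAlgClosed k] {m : ℕ}
    (G : Subgroup (GL (Fin m) k)) (hG : MuStab.IsLinearAlgebraicGroup G)
    {U : Type v} [Field U] [Algebra k U] [MuStab.LocModel k U] (hU : MuStab.IsMonster k U)
    (p : MuStab.TypesOver k U (Fin m × Fin m)) (hp : MuStab.IsTypeOn G p) :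
    MuStab.zdim (MuStab.muStab G p) = MuStab.zdim (MuStab.GbarPoints G p) ∧
    MuStab.zdim (MuStab.GbarPoints G p) ≤ MuStab.typeDim p ∧
    IsLeast {d | ∃ ψ, MuStab.Contains p ψ ∧ MuStab.IsGFormula G U ψ ∧ d = MuStab.vfDim U ψ}
      (MuStab.typeDim p) := by
  have : Infinite k := IsAlgClosed.instInfinite
  refine ⟨by rw [MuStab.muStab_eq_GbarPoints hU hp], MuStab.zdim_GbarPoints_le hU hp, ?_, ?_⟩
  · obtain ⟨ψ, hψ, hψG, h⟩ := MuStab.exists_formulaClosure_eq hU hp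
    exact ⟨ψ, hψ, hψG, congrArg MuStab.zdim h.symm⟩
  · rintro _ ⟨ψ, hψ, -, rfl⟩
    exact MuStab.zdim_mono (MuStab.typeClosure_subset_formulaClosure hψ)
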